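/- Let $d\ge 0$ be an integer and let $\mathbb B^d$ be the open unit ball of $\mathbb C^d$. For $\sigma>d$ put $d\mu_\sigma(z)=c_\sigma(1-|z|^2)^{\sigma-d-1}\,dz$ on $\mathbb B^d$, with $dz$ Lebesgue measure and $c_\sigma=\Gamma(\sigma)/(\pi^d\Gamma(\sigma-d))$, and let $\mathcal HL^2(\mathbb B^d,\mu_\sigma)$ be the space of holomorphic functions on $\mathbb B^d$ that are square-integrable with respect to $\mu_\sigma$. (i) Let $\lambda>d$. Then $L^2(\mathbb B^d,\mu_\lambda)$ has an orthogonal projection $P_\lambda$ onto $\mathcal HL^2(\mathbb B^d,\mu_\lambda)$. For every bounded measurable $\phi$ on $\mathbb B^d$ the Toeplitz operator $T_\phi f=P_\lambda(\phi f)$ on $\mathcal HL^2(\mathbb B^d,\mu_\lambda)$ satisfies: 1. $\|T_\phi\|\le\sup_{z\in\mathbb B^d}|\phi(z)|$; 2. if $\phi(z)\ge 0$ for all $z\in\mathbb B^d$, then $T_\phi$ is a positive operator. (ii) Let $0<\lambda<d$ and let $n$ be any non-negative integer with $\lambda+2n>d$. Let $N=\sum_{j=1}^d z_j\,\partial/\partial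 z_j$, and let $H(\mathbb B^d,\lambda)$ be the space of holomorphic functions $f$ on $\mathbb B^d$ with $N^kf\in\mathcal HL^2(\mathbb B^d,\mu_{\lambda+2n})$ for $0\le k\le n$. Put $$\langle f,g\rangle_\lambda=\langle Af,Bg\rangle_{L^2(\mathbb B^d,\mu_{\lambda+2n})},\qquad A=\prod_{i=n}^{2n-1}\Bigl(I+\frac N{\lambda+i}\Bigr),\quad B=\prod_{i=0}^{n-1}\Bigl(I+\frac N{\lambda+i}\Bigr).$$ Then $H(\mathbb B^d,\lambda)$ is a Hilbert space with inner product $\langle\cdot,\cdot\rangle_\lambda$, and multiplication by $z^m$ is a bounded operator $M_{z^m}$ on it for every multi-index $m$. For a polynomial $\phi$ in $z$ and $\bar z$, let $T_\phi$ be the bounded operator on $H(\mathbb B^d,\lambda)$ that is linear in $\phi$ and satisfies $T_{\bar z^mz^l}=(M_{z^m})^*M_{z^l}$. Then both properties fail for polynomial symbols: 1. for $\phi(z)=|z|^2$ one has $\|T_\phi\|>\sup_{z\in\mathbb B^d}|\phi(z)|$; 2. the polynomial $\psi(z)=1-|z|^2$ is non-negative on $\mathbb B^d$, but $T_\psi$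 is not a positive operator; indeed $\langle f,T_\psi f\rangle_\lambda$ has negative real part for some $f\in H(\mathbb B^d,\lambda)$. Moreover, there is no constant $C$ such that $\|T_\phi\|\le C\sup_{z\in\mathbb B^d}|\phi(z)|$ for all polynomials $\phi$ in $z$ and $\bar z$. There is no such constant even for the polynomials $\phi_k(z)=|z|^{2k}$, $k=0,1,2,\dots$, alone. -/

import Mathlib

open MeasureTheory
open scoped ENNReal

namespace GenBergman

noncomputable section

/-- Complex Euclidean space `ℂ^d`, with the Hermitian norm `|z|² = ∑ |z_j|²`. -/
abbrev Cn (d : ℕ) : Type := EuclideanSpace ℂ (Fin d)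

/-- The open unit ball `𝔹^d` of `ℂ^d`. -/
abbrev unitBall (d : ℕ) : Set (Cn d) := Metric.ball 0 1

/-- The hyperbolic volume measure `dτ = (1 - |z|²)^{-(d+1)} dz` on the ball, where `dz` is the
`2d`-dimensional Lebesgue measure. -/
def hypVolume (d : ℕ) : Measure (Cn d) :=
  (volume.restrict (unitBall d)).withDensity
    fun z => ENNReal.ofReal (((1 - ‖z‖ ^ 2) ^ (d + 1))⁻¹)

/-- The constant `c_σ = Γ(σ) / (π^d Γ(σ - d))`, which normalizes `μ_σ` for `σ > d`. -/
def cConst (d : ℕ) (σ : ℝ) : ℝ := Real.Gamma σ / (Real.pi ^ d * Real.Gamma (σ - d))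

/-- The measure `dμ_σ = c_σ (1 - |z|²)^σ dτ`, used for `σ > d` only. -/
def bergmanMeasure (d : ℕ) (σ : ℝ) : Measure (Cn d) :=
  (hypVolume d).withDensity fun z => ENNReal.ofReal (cConst d σ * (1 - ‖z‖ ^ 2) ^ σ)

/-! ### Bergman spaces and multiply-and-project Toeplitz operators -/

/-- The Bergman space `𝓗L²(𝔹^d, μ_σ)`: the classes in `L²(𝔹^d, μ_σ)` that are represented by a
function holomorphic on the ball. -/
def bergman (d : ℕ) (σ : ℝ) : Submodule ℂ (Lp ℂ 2 (bergmanMeasure d σ)) where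
  carrier := {F | ∃ f : Cn d → ℂ, DifferentiableOn ℂ f (unitBall d) ∧
    F =ᵐ[bergmanMeasure d σ] f}
  zero_mem' := ⟨0, differentiableOn_const 0, Lp.coeFn_zero ℂ 2 _⟩
  add_mem' := by
    rintro F G ⟨f, hf, hF⟩ ⟨g, hg, hG⟩
    exact ⟨f + g, hf.add hg, (Lp.coeFn_add F G).trans (hF.add hG)⟩
  smul_mem' := by
    rintro c F ⟨f, hf, hF⟩
    exact ⟨c • f, hf.const_smul c, (Lp.coeFn_smul c F).trans (hF.const_smul c)⟩

/-- `φ` is bounded on the ball. -/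
def BddOnBall {d : ℕ} (φ : Cn d → ℂ) : Prop := ∃ C : ℝ, ∀ z ∈ unitBall d, ‖φ z‖ ≤ C

theorem ae_mem_unitBall (d : ℕ) (σ : ℝ) : ∀ᵐ z ∂(bergmanMeasure d σ), z ∈ unitBall d := by
  have h : bergmanMeasure d σ ≪ volume.restrict (unitBall d) :=
    (withDensity_absolutelyContinuous _ _).trans (withDensity_absolutelyContinuous _ _)
  exact h.ae_le (ae_restrict_mem measurableSet_ball)

theorem memLp_top {d : ℕ} (σ : ℝ) {φ : Cn d → ℂ} (hm : Measurable φ) (hb : BddOnBall φ) :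
    MemLp φ ∞ (bergmanMeasure d σ) := by
  obtain ⟨C, hC⟩ := hb
  exact memLp_top_of_bound hm.aestronglyMeasurable C
    ((ae_mem_unitBall d σ).mono fun z hz => hC z hz)

/-- The operator of multiplication by a bounded measurable function on `L²(𝔹^d, μ_σ)`. -/
def mulOp {d : ℕ} (σ : ℝ) {φ : Cn d → ℂ} (hm : Measurable φ) (hb : BddOnBall φ) :
    Lp ℂ 2 (bergmanMeasure d σ) →L[ℂ] Lp ℂ 2 (bergmanMeasure d σ) :=
  (ContinuousLinearMap.mul ℂ ℂ).holderL (bergmanMeasure d σ) ∞ 2 2 ((memLp_top σ hm hb).toLp φ)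

/-- The Toeplitz operator `T_φ f = P_σ (φ f)` on the Bergman space. -/
def toeplitz {d : ℕ} (σ : ℝ) [(bergman d σ).HasOrthogonalProjection]
    {φ : Cn d → ℂ} (hm : Measurable φ) (hb : BddOnBall φ) :
    bergman d σ →L[ℂ] bergman d σ :=
  (bergman d σ).orthogonalProjectionOnto ∘L mulOp σ hm hb ∘L (bergman d σ).subtypeL

/-! ### Generalized Bergman spaces (holomorphic Sobolev spaces) -/

/-- The number operator `N = ∑ z_j ∂/∂z_j`, i.e. the complex derivative of `f` at `z` in the
direction `z`. -/
def numOp {d : ℕ} (f : Cn d → ℂ) : Cn d → ℂ := fun z => fderiv ℂ f z z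

/-- `shiftProd a k` is `(I + N/a) (I + N/(a+1)) ⋯ (I + N/(a+k-1))`. -/
def shiftProd {d : ℕ} (a : ℝ) : ℕ → (Cn d → ℂ) → (Cn d → ℂ)
  | 0, f => f
  | k + 1, f => fun z =>
      shiftProd a k f z + numOp (shiftProd a k f) z / ((a + k : ℝ) : ℂ)

theorem numOp_congr {d : ℕ} {f g : Cn d → ℂ} (h : Set.EqOn f g (unitBall d)) :
    Set.EqOn (numOp f) (numOp g) (unitBall d) := by
  intro z hz
  have : f =ᶠ[nhds z] g := h.eventuallyEq_of_mem (Metric.isOpen_ball.mem_nhds hz)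
  simp only [numOp, this.fderiv_eq]

theorem iterate_numOp_add {d : ℕ} {f g : Cn d → ℂ} {n : ℕ}
    (hf : ∀ k ≤ n, DifferentiableOn ℂ (numOp^[k] f) (unitBall d))
    (hg : ∀ k ≤ n, DifferentiableOn ℂ (numOp^[k] g) (unitBall d)) :
    ∀ k ≤ n, Set.EqOn (numOp^[k] (f + g)) (numOp^[k] f + numOp^[k] g) (unitBall d) := by
  intro k
  induction k with
  | zero => intro _ z _; rfl
  | succ k ih =>
    intro hk z hz
    have hk' : k ≤ n := by omega
    have hz' := Metric.isOpen_ball.mem_nhds hz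
    rw [Function.iterate_succ_apply', numOp_congr (ih hk') hz]
    simp only [numOp, Pi.add_apply, Function.iterate_succ_apply']
    rw [fderiv_add ((hf k hk').differentiableAt hz') ((hg k hk').differentiableAt hz')]
    rfl

theorem iterate_numOp_smul {d : ℕ} (c : ℂ) {f : Cn d → ℂ} {n : ℕ}
    (hf : ∀ k ≤ n, DifferentiableOn ℂ (numOp^[k] f) (unitBall d)) :
    ∀ k ≤ n, Set.EqOn (numOp^[k] (c • f)) (c • numOp^[k] f) (unitBall d) := by
  intro k
  induction k with
  | zero => intro _ z _; rfl
  | succ k ih =>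
    intro hk z hz
    have hk' : k ≤ n := by omega
    have hz' := Metric.isOpen_ball.mem_nhds hz
    rw [Function.iterate_succ_apply', numOp_congr (ih hk') hz]
    simp only [numOp, Pi.smul_apply, Function.iterate_succ_apply']
    rw [fderiv_const_smul ((hf k hk').differentiableAt hz')]
    rfl

theorem iterate_numOp_zero {d : ℕ} (k : ℕ) : numOp^[k] (0 : Cn d → ℂ) = 0 := by
  induction k with
  | zero => rfl
  | succ k ih =>
    rw [Function.iterate_succ_apply', ih]
    funext z
    simp [numOp]

/-- The vector space `H(𝔹^d, lam)`, for `lam + 2n > d`: the holomorphic functions `f` on the ball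
such that `N^k f` belongs to `𝓗L²(𝔹^d, μ_{lam+2n})` for `0 ≤ k ≤ n`. A function on the ball is
represented by its extension by `0` to `ℂ^d`. -/
def genBergman (d : ℕ) (lam : ℝ) (n : ℕ) : Submodule ℂ (Cn d → ℂ) where
  carrier := {f | (∀ z, z ∉ unitBall d → f z = 0) ∧
    ∀ k ≤ n, DifferentiableOn ℂ (numOp^[k] f) (unitBall d) ∧
      MemLp (numOp^[k] f) 2 (bergmanMeasure d (lam + 2 * n))}
  zero_mem' := by
    refine ⟨fun _ _ => rfl, fun k _ => ?_⟩
    rw [iterate_numOp_zero]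
    exact ⟨differentiableOn_const 0, MemLp.zero⟩
  add_mem' := by
    rintro f g ⟨hf0, hf⟩ ⟨hg0, hg⟩
    refine ⟨fun z hz => by simp [hf0 z hz, hg0 z hz], fun k hk => ?_⟩
    have h := iterate_numOp_add (fun j hj => (hf j hj).1) (fun j hj => (hg j hj).1) k hk
    refine ⟨((hf k hk).1.add (hg k hk).1).congr h, ?_⟩
    refine (memLp_congr_ae ?_).2 ((hf k hk).2.add (hg k hk).2)
    exact (ae_mem_unitBall d _).mono fun z hz => h hz
  smul_mem' := by
    rintro c f ⟨hf0, hf⟩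
    refine ⟨fun z hz => by simp [hf0 z hz], fun k hk => ?_⟩
    have h := iterate_numOp_smul c (fun j hj => (hf j hj).1) k hk
    refine ⟨((hf k hk).1.const_smul c).congr h, ?_⟩
    refine (memLp_congr_ae ?_).2 ((hf k hk).2.const_smul c)
    exact (ae_mem_unitBall d _).mono fun z hz => h hz

/-- The inner product `⟨f, g⟩_lam = ⟨A f, B g⟩` in `L²(𝔹^d, μ_{lam+2n})`, where
`A = (I + N/(lam+n)) ⋯ (I + N/(lam+2n-1))` and `B = (I + N/lam) ⋯ (I + N/(lam+n-1))`. -/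
def sobolevForm (d : ℕ) (lam : ℝ) (n : ℕ) (f g : Cn d → ℂ) : ℂ :=
  ∫ z, starRingEnd ℂ (shiftProd (lam + n) n f z) * shiftProd lam n g z
    ∂(bergmanMeasure d (lam + 2 * n))

/-! ### Toeplitz operators with polynomial symbols -/

/-- Polynomials in `z̄_1, …, z̄_d` (variables `Sum.inl j`) and `z_1, …, z_d` (variables
`Sum.inr j`). -/
abbrev PolySymbol (d : ℕ) : Type := MvPolynomial (Fin d ⊕ Fin d) ℂ

/-- The function on `ℂ^d` given by a polynomial in `z̄` and `z`. -/
def PolySymbol.toFun {d : ℕ} (φ : PolySymbol d) (z : Cn d) : ℂ :=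
  MvPolynomial.eval (Sum.elim (fun j => starRingEnd ℂ (z j)) (fun j => z j)) φ

/-- The supremum of `|φ|` over the ball. -/
def supOnBall {d : ℕ} (φ : Cn d → ℂ) : ℝ := ⨆ z : unitBall d, ‖φ z‖

/-- The polynomial `|z|² = ∑ z̄_j z_j`. -/
def normSqSymbol (d : ℕ) : PolySymbol d :=
  ∑ j : Fin d, MvPolynomial.X (Sum.inl j) * MvPolynomial.X (Sum.inr j)

/-- Given the multiplication operators `M m = M_{z^m}` on a Hilbert space, the Toeplitz operator
of a polynomial symbol: linear in the symbol, with `T_{z̄^m z^l} = (M_{z^m})* M_{z^l}`. -/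
def polyToeplitz {d : ℕ} {H : Type*} [NormedAddCommGroup H] [InnerProductSpace ℂ H]
    [CompleteSpace H] (M : (Fin d → ℕ) → H →L[ℂ] H) (φ : PolySymbol d) : H →L[ℂ] H :=
  ∑ s ∈ φ.support, φ.coeff s •
    (ContinuousLinearMap.adjoint (M fun j => s (Sum.inl j)) ∘L M fun j => s (Sum.inr j))

end

end GenBergman

open GenBergman Filter Topology ComplexConjugate

/-! ### Rotation invariance and averages over circles -/

/-! The mean value property on balls and the Cauchy-Schwarz inequality bound a holomorphic function
on a compact part of the ball by its `L²(μ_σ)` norm; Cauchy's estimate does the same for its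
derivative. Hence `L²` limits of holomorphic functions are holomorphic
(`exists_differentiableOn_limit`) and the Bergman space is closed. Part (i) follows: `T_φ` is
multiplication by `φ` followed by a contraction, and `⟨T_φ f, f⟩` is the integral of `conj φ |f|²`.

For the Hilbert space of part (ii), the measure is invariant under `z ↦ e^{iθ} z`, so integrals may
be averaged over circles. There `N` becomes `t d/dt`, which is symmetric (integrate over a period)
and nonnegative (it multiplies `t^k` by `k`). So `⟨N^j f, N^k f⟩` depends only on `j + k` and is
nonnegative for `g = f`. Since `A` and `B` are polynomials of degree `n` in `N` with positive
coefficients, `⟨Af, Bf⟩` dominates a multiple of every `‖N^k f‖²`, `k ≤ n` (`mul_norm_npow_sq_le`).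
This gives definiteness and completeness; multiplication by `z^m` is then bounded by the closed
graph theorem.

Both properties fail already on the constant function `1`. Put `m_k = ⟨1, T_{|z|^{2k}} 1⟩`. On
homogeneous polynomials of degree `k` the product `AB` is the scalar `∏_{i<2n} (1 + k/(λ+i))`, so
`m_k` is this scalar times `∫ |z|^{2k} dμ_{λ+2n}`. From `k` to `k+1` the scalar grows by
`(λ+2n+k)/(λ+k)` and the integral by `(d+k)/(λ+2n+k)`. Therefore `m_{k+1}/m_k = (d+k)/(λ+k)`
(`moment_succ`), which exceeds `1` exactly because `λ < d`. Now `m_1 > m_0 = ‖1‖²` gives the norm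
bound and the negative value of `⟨1, T_ψ 1⟩`, and `m_k → ∞` by comparison with the harmonic series,
while `|z|^{2k} ≤ 1` on the ball. -/

/-- A measure on `ℂ^d` is circular if it is invariant under `z ↦ c z`, `|c| = 1`. -/
def IsCircular {d : ℕ} (μ : Measure (Cn d)) : Prop :=
  ∀ c : ℂ, ‖c‖ = 1 → MeasurePreserving (fun z : Cn d => c • z) μ μ

theorem isCircular_volume (d : ℕ) : IsCircular (volume : Measure (Cn d)) := by
  intro c hc
  let e : Cn d ≃ₗᵢ[ℝ] Cn d :=
    { toLinearEquiv := (LinearEquiv.smulOfNeZero ℂ (Cn d) c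
        (by intro h; simp [h] at hc)).restrictScalars ℝ
      norm_map' := fun z => by
        change ‖c • z‖ = ‖z‖
        rw [norm_smul, hc, one_mul] }
  exact e.measurePreserving

theorem IsCircular.withDensity {d : ℕ} {μ : Measure (Cn d)} (hμ : IsCircular μ)
    {ρ : Cn d → ℝ≥0∞} (hm : Measurable ρ) (hρ : ∀ c : ℂ, ‖c‖ = 1 → ∀ z, ρ (c • z) = ρ z) :
    IsCircular (μ.withDensity ρ) := by
  intro c hc
  refine ⟨measurable_const_smul c, ?_⟩
  ext s hs
  rw [Measure.map_apply (measurable_const_smul c) hs,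
    withDensity_apply _ (measurable_const_smul c hs), withDensity_apply _ hs,
    ← (hμ c hc).setLIntegral_comp_preimage hs hm]
  simp only [hρ c hc]

theorem IsCircular.restrict_ball {d : ℕ} {μ : Measure (Cn d)} (hμ : IsCircular μ) (r : ℝ) :
    IsCircular (μ.restrict (Metric.ball 0 r)) := by
  intro c hc
  have h : (fun z : Cn d => c • z) ⁻¹' (Metric.ball 0 r) = Metric.ball 0 r := by
    ext z
    simp [norm_smul, hc]
  have := (hμ c hc).restrict_preimage (s := Metric.ball 0 r) measurableSet_ball
  rwa [h] at this

theorem measurable_hypDensity (d : ℕ) :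
    Measurable fun z : Cn d => ENNReal.ofReal (((1 - ‖z‖ ^ 2) ^ (d + 1))⁻¹) := by
  fun_prop

theorem measurable_bergmanDensity (d : ℕ) (σ : ℝ) :
    Measurable fun z : Cn d => ENNReal.ofReal (cConst d σ * (1 - ‖z‖ ^ 2) ^ σ) := by
  fun_prop

theorem isCircular_bergmanMeasure (d : ℕ) (σ : ℝ) : IsCircular (bergmanMeasure d σ) := by
  refine IsCircular.withDensity (IsCircular.withDensity
    ((isCircular_volume d).restrict_ball 1) (measurable_hypDensity d) ?_)
    (measurable_bergmanDensity d σ) ?_ <;>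
  · intro c hc z
    simp only [norm_smul, hc, one_mul]

instance (d : ℕ) : SFinite (hypVolume d) := by unfold hypVolume; infer_instance

instance (d : ℕ) (σ : ℝ) : SFinite (bergmanMeasure d σ) := by
  unfold bergmanMeasure; infer_instance

/-- Fubini: for each fixed angle the rotation preserves `μ`, so averaging over the angle changes
nothing. -/
theorem IsCircular.integral_circleAverage {d : ℕ} {μ : Measure (Cn d)} [SFinite μ]
    (hμ : IsCircular μ) {h : Cn d → ℂ} (hh : Integrable h μ) :
    ∫ z, Real.circleAverage (fun t => h (t • z)) 0 1 ∂μ = ∫ z, h z ∂μ := by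
  let ν : Measure ℝ := volume.restrict (Set.Ioc 0 (2 * Real.pi))
  -- Rotating the second coordinate by the angle in the first preserves the product measure; this
  -- supplies the joint integrability that Fubini needs.
  have hΦ : MeasurePreserving (fun p : ℝ × Cn d => (p.1, circleMap 0 1 p.1 • p.2))
      (ν.prod μ) (ν.prod μ) := by
    refine (MeasurePreserving.id ν).skew_product (g := fun θ z => circleMap 0 1 θ • z) ?_
      (ae_of_all _ fun θ => (hμ _ (by simp)).map_eq)
    have : Continuous fun p : ℝ × Cn d => circleMap 0 1 p.1 • p.2 := by
      have := continuous_circleMap 0 1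
      fun_prop
    exact this.measurable
  have hint : Integrable (fun p : ℝ × Cn d => h (circleMap 0 1 p.1 • p.2)) (ν.prod μ) :=
    hΦ.integrable_comp_of_integrable (hh.comp_snd ν)
  have hθ : ∀ θ : ℝ, ∫ z, h (circleMap 0 1 θ • z) ∂μ = ∫ z, h z ∂μ := by
    intro θ
    have hmp := hμ (circleMap 0 1 θ) (by simp)
    have hne : circleMap 0 1 θ ≠ 0 := circleMap_ne_center one_ne_zero
    exact hmp.integral_comp (Homeomorph.smulOfNeZero _ hne).measurableEmbedding h
  simp only [Real.circleAverage, intervalIntegral.integral_of_le Real.two_pi_pos.le]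
  rw [integral_smul]
  change (2 * Real.pi)⁻¹ • ∫ z, ∫ θ, h (circleMap 0 1 θ • z) ∂ν ∂μ = _
  rw [← integral_integral_swap (f := fun θ z => h (circleMap 0 1 θ • z)) hint]
  simp only [hθ]
  rw [integral_const]
  have : ν.real Set.univ = 2 * Real.pi := by
    simp [ν, Measure.real, Real.pi_pos.le]
  rw [this, smul_smul, inv_mul_cancel₀ Real.two_pi_pos.ne', one_smul]

/-! ### The operator `t d/dt` on the unit circle -/

/-- The derivative of `conj φ * ψ` along the circle integrates to zero by periodicity. Since `d/dθ =
i t d/dt` and conjugation turns `i` into `-i`, that derivative is `i` times the difference of the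
two integrands. -/
theorem circleAverage_conj_mul_deriv {U : Set ℂ} (hU : IsOpen U) (h1 : Metric.sphere 0 1 ⊆ U)
    {φ ψ : ℂ → ℂ} (hφ : DifferentiableOn ℂ φ U) (hψ : DifferentiableOn ℂ ψ U) :
    Real.circleAverage (fun t => conj (t * deriv φ t) * ψ t) 0 1 =
      Real.circleAverage (fun t => conj (φ t) * (t * deriv ψ t)) 0 1 := by
  have hc : ∀ θ : ℝ, circleMap 0 1 θ ∈ U := fun θ => h1 (by simp)
  have hd : ∀ {χ : ℂ → ℂ}, DifferentiableOn ℂ χ U → ∀ θ : ℝ,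
      HasDerivAt (fun θ : ℝ => χ (circleMap 0 1 θ))
        (deriv χ (circleMap 0 1 θ) * (circleMap 0 1 θ * Complex.I)) θ := fun hχ θ =>
    ((hχ.differentiableAt (hU.mem_nhds (hc θ))).hasDerivAt.comp θ (hasDerivAt_circleMap 0 1 θ))
  have hcont : ∀ {χ : ℂ → ℂ}, DifferentiableOn ℂ χ U →
      Continuous fun θ : ℝ => χ (circleMap 0 1 θ) := fun hχ =>
    hχ.continuousOn.comp_continuous (continuous_circleMap 0 1) hc
  have c1 := hcont hφ
  have c2 := hcont hψ
  have c3 := hcont (hφ.deriv hU)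
  have c4 := hcont (hψ.deriv hU)
  have c5 := continuous_circleMap 0 1
  have key := intervalIntegral.integral_eq_sub_of_hasDerivAt (a := 0) (b := 2 * Real.pi)
    (fun θ _ => ((hd hφ θ).star).mul (hd hψ θ)) (Continuous.intervalIntegrable
      (((c3.mul (c5.mul continuous_const)).star.mul c2).add
        (c1.star.mul (c4.mul (c5.mul continuous_const)))) _ _)
  have hp : circleMap 0 1 (2 * Real.pi) = circleMap 0 1 0 := by simp [circleMap]
  simp only [Pi.mul_apply, hp, sub_self] at key
  have e : ∀ θ : ℝ, star (deriv φ (circleMap 0 1 θ) * (circleMap 0 1 θ * Complex.I)) *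
        ψ (circleMap 0 1 θ) + star (φ (circleMap 0 1 θ)) *
          (deriv ψ (circleMap 0 1 θ) * (circleMap 0 1 θ * Complex.I)) =
      Complex.I * (conj (φ (circleMap 0 1 θ)) * (circleMap 0 1 θ * deriv ψ (circleMap 0 1 θ)) -
      conj (circleMap 0 1 θ * deriv φ (circleMap 0 1 θ)) * ψ (circleMap 0 1 θ)) := by
    intro θ
    simp only [RCLike.star_def, map_mul, Complex.conj_I]
    ring
  simp only [e] at key
  have i1 : Continuous fun θ : ℝ =>
      conj (φ (circleMap 0 1 θ)) * (circleMap 0 1 θ * deriv ψ (circleMap 0 1 θ)) :=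
    c1.star.mul (c5.mul c4)
  have i2 : Continuous fun θ : ℝ =>
      conj (circleMap 0 1 θ * deriv φ (circleMap 0 1 θ)) * ψ (circleMap 0 1 θ) :=
    (c5.mul c3).star.mul c2
  rw [intervalIntegral.integral_const_mul, intervalIntegral.integral_sub
    (i1.intervalIntegrable _ _) (i2.intervalIntegrable _ _)] at key
  have := (mul_eq_zero.1 key).resolve_left Complex.I_ne_zero
  rw [Real.circleAverage, Real.circleAverage, sub_eq_zero.1 this]

theorem mul_deriv_pow (k : ℕ) (t : ℂ) : t * deriv (fun t : ℂ => t ^ k) t = k * t ^ k := by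
  rcases k with _ | k
  · simp
  · simp only [deriv_pow_field, Nat.add_sub_cancel]
    ring

/-- For `j ≠ k` these are eigenvectors of the symmetric operator `t d/dt` with different
eigenvalues. -/
theorem circleAverage_conj_pow_mul_pow (j k : ℕ) :
    Real.circleAverage (fun t : ℂ => conj (t ^ j) * t ^ k) 0 1 = if j = k then 1 else 0 := by
  split_ifs with h
  · subst h
    have : Set.EqOn (fun t : ℂ => conj (t ^ j) * t ^ j) (fun _ => (1 : ℂ))
        (Metric.sphere 0 |1|) := by
      intro t ht
      have ht : ‖t‖ = 1 := by simpa using ht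
      simp [← mul_pow, Complex.conj_mul', ht]
    rw [Real.circleAverage_congr_sphere this, Real.circleAverage_const]
  · have := circleAverage_conj_mul_deriv isOpen_univ (Set.subset_univ _)
      (differentiable_pow j).differentiableOn (differentiable_pow k).differentiableOn
    simp only [mul_deriv_pow, map_mul, map_natCast] at this
    have e1 : (fun t : ℂ => (j : ℂ) * conj (t ^ j) * t ^ k) =
        (j : ℂ) • fun t : ℂ => conj (t ^ j) * t ^ k := by
      funext t; simp; ring
    have e2 : (fun t : ℂ => conj (t ^ j) * ((k : ℂ) * t ^ k)) =
        (k : ℂ) • fun t : ℂ => conj (t ^ j) * t ^ k := by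
      funext t; simp; ring
    rw [e1, e2, Real.circleAverage_smul, Real.circleAverage_smul, smul_eq_mul, smul_eq_mul] at this
    have h2 : ((j : ℂ) - k) * Real.circleAverage (fun t : ℂ => conj (t ^ j) * t ^ k) 0 1 = 0 := by
      rw [sub_mul, this, sub_self]
    exact (mul_eq_zero.1 h2).resolve_left (sub_ne_zero.2 (by exact_mod_cast h))

theorem hasSum_circleAverage_conj_mul {φ : ℂ → ℂ} {a : ℕ → ℂ} (ha : Summable fun k => ‖a k‖)
    (hφ : ∀ t : ℂ, ‖t‖ = 1 → HasSum (fun k => a k * t ^ k) (φ t)) {G : ℂ → ℂ}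
    (hG : ContinuousOn G (Metric.sphere 0 1)) :
    HasSum (fun k => conj (a k) * Real.circleAverage (fun t => conj (t ^ k) * G t) 0 1)
      (Real.circleAverage (fun t => conj (φ t) * G t) 0 1) := by
  have c5 := continuous_circleMap 0 1
  have cG : Continuous fun θ : ℝ => G (circleMap 0 1 θ) :=
    hG.comp_continuous c5 (fun θ => by simp)
  have n1 : ∀ θ : ℝ, ‖circleMap 0 1 θ‖ = 1 := fun θ => by simp
  obtain ⟨C, hC⟩ := (isCompact_sphere (0 : ℂ) 1).exists_bound_of_continuousOn hG
  have key := intervalIntegral.hasSum_integral_of_dominated_convergence (μ := volume)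
    (a := 0) (b := 2 * Real.pi) (f := fun θ => conj (φ (circleMap 0 1 θ)) * G (circleMap 0 1 θ))
    (F := fun k θ => conj (a k * circleMap 0 1 θ ^ k) * G (circleMap 0 1 θ))
    (fun k _ => ‖a k‖ * C)
    (fun k => Continuous.aestronglyMeasurable
      ((continuous_const.mul (c5.pow k)).star.mul cG))
    (fun k => ae_of_all _ fun θ _ => by
      have := hC (circleMap 0 1 θ) (by simp)
      simp only [norm_mul, RCLike.norm_conj, norm_pow, n1, one_pow, mul_one]
      gcongr)
    (ae_of_all _ fun θ _ => ha.mul_right C)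
    (by simp)
    (ae_of_all _ fun θ _ =>
      (((hφ _ (n1 θ)).map (starRingEnd ℂ) Complex.continuous_conj)).mul_right _)
  have key2 := key.const_smul ((2 * Real.pi)⁻¹)
  have e : ∀ k, (2 * Real.pi)⁻¹ • ∫ θ in (0 : ℝ)..2 * Real.pi,
      conj (a k * circleMap 0 1 θ ^ k) * G (circleMap 0 1 θ) =
      conj (a k) * Real.circleAverage (fun t => conj (t ^ k) * G t) 0 1 := by
    intro k
    rw [Real.circleAverage, mul_smul_comm, ← intervalIntegral.integral_const_mul]
    simp only [map_mul, mul_assoc]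
  simp only [e] at key2
  exact key2

theorem circleAverage_conj (f : ℂ → ℂ) (c : ℂ) (R : ℝ) :
    Real.circleAverage (fun t => conj (f t)) c R = conj (Real.circleAverage f c R) := by
  simp only [Real.circleAverage, intervalIntegral.intervalIntegral_eq_integral_uIoc,
    integral_conj, Complex.real_smul, map_mul, Complex.conj_ofReal]

/-- With `φ = ∑ a_k t^k` the average equals `∑ k |a_k|²`. Holomorphy beyond the unit circle makes
the coefficients absolutely summable, so the series can be integrated term by term. -/
theorem circleAverage_conj_mul_deriv_nonneg {R : ℝ} (hR : 1 < R)
    {φ : ℂ → ℂ} (hφ : DifferentiableOn ℂ φ (Metric.ball 0 R)) :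
    ∃ r : ℝ, 0 ≤ r ∧ Real.circleAverage (fun t => conj (φ t) * (t * deriv φ t)) 0 1 = r := by
  obtain ⟨S, hS1, hSR⟩ := exists_between hR
  lift S to NNReal using by linarith
  have hps := (hφ.mono (Metric.closedBall_subset_ball hSR)).hasFPowerSeriesOnBall
    (lt_trans one_pos hS1)
  set p := cauchyPowerSeries φ 0 S
  have h1S : ((1 : NNReal) : ℝ≥0∞) < S := by exact_mod_cast hS1
  have ha : Summable fun k => ‖p.coeff k‖ := by
    have := p.summable_norm_mul_pow (r := 1) (h1S.trans_le hps.r_le)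
    simpa using this
  have hsum : ∀ t : ℂ, ‖t‖ = 1 → HasSum (fun k => p.coeff k * t ^ k) (φ t) := by
    intro t ht
    have := hps.hasSum (y := t) (by
      rw [Metric.mem_eball, edist_zero_right, ← ofReal_norm, ht]
      simpa using h1S)
    simpa [FormalMultilinearSeries.apply_eq_pow_smul_coeff, mul_comm] using this
  have hsub : Metric.sphere (0 : ℂ) 1 ⊆ Metric.ball 0 R :=
    Metric.sphere_subset_closedBall.trans (Metric.closedBall_subset_ball hR)
  have key := hasSum_circleAverage_conj_mul ha hsum (G := fun t => t * deriv φ t)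
    (continuousOn_id.mul ((hφ.deriv Metric.isOpen_ball).continuousOn.mono hsub))
  -- Symmetry moves `t d/dt` from `φ` onto `t^k`, so only the Taylor coefficients of `φ` itself have
  -- to be computed.
  have hcoef : ∀ k, Real.circleAverage (fun t => conj (t ^ k) * (t * deriv φ t)) 0 1 =
      k * p.coeff k := by
    intro k
    have h0 := hasSum_circleAverage_conj_mul ha hsum (G := fun t => t ^ k)
      (by fun_prop)
    simp only [circleAverage_conj_pow_mul_pow] at h0
    have h1 : Real.circleAverage (fun t => conj (φ t) * t ^ k) 0 1 = conj (p.coeff k) := by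
      refine h0.unique ?_
      convert hasSum_ite_eq k (conj (p.coeff k)) using 2 with j
      split_ifs with h <;> simp [h]
    have h2 := circleAverage_conj_mul_deriv Metric.isOpen_ball hsub
      (differentiable_pow k).differentiableOn hφ
    simp only [mul_deriv_pow, map_mul, map_natCast] at h2
    rw [← h2]
    have e1 : (fun t : ℂ => (k : ℂ) * conj (t ^ k) * φ t) =
        (k : ℂ) • fun t : ℂ => conj (conj (φ t) * t ^ k) := by
      funext t; simp; ring
    rw [e1, Real.circleAverage_smul, circleAverage_conj, h1, Complex.conj_conj, smul_eq_mul]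
  simp only [hcoef] at key
  refine ⟨∑' k, k * ‖p.coeff k‖ ^ 2, by positivity, ?_⟩
  have e : ∀ k : ℕ, conj (p.coeff k) * (k * p.coeff k) = ((k * ‖p.coeff k‖ ^ 2 : ℝ) : ℂ) := by
    intro k
    rw [mul_left_comm, Complex.conj_mul']
    push_cast; rfl
  simp only [e] at key
  rw [← key.tsum_eq, Complex.ofReal_tsum]

/-! ### Local bounds for square-integrable holomorphic functions -/

theorem differentiableOn_slice {d : ℕ} {f : Cn d → ℂ} {r : ℝ} {w : Cn d}
    (hf : DifferentiableOn ℂ f (Metric.ball w r)) {z : Cn d} {R : ℝ} (hz : R * ‖z‖ ≤ r)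
    (hz0 : 0 < r) :
    DifferentiableOn ℂ (fun t : ℂ => f (w + t • z)) (Metric.ball 0 R) := by
  refine hf.comp (by fun_prop) fun t ht => ?_
  have ht : ‖t‖ < R := by simpa using ht
  rw [Metric.mem_ball, dist_self_add_left, norm_smul]
  rcases (norm_nonneg z).eq_or_lt with h | h
  · rw [← h, mul_zero]; exact hz0
  · exact (mul_lt_mul_of_pos_right ht h).trans_le hz

/-- A ball about `w` is a union of circles `w + t z`, `|t| = 1`, and the one-variable mean value
property gives the average `f w` on each of them. -/
theorem setIntegral_ball_of_differentiableOn {d : ℕ} {f : Cn d → ℂ} {w : Cn d} {r : ℝ}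
    (hr : 0 < r) {U : Set (Cn d)} (hU : Metric.closedBall w r ⊆ U) (hf : DifferentiableOn ℂ f U) :
    ∫ z in Metric.ball w r, f z = volume.real (Metric.ball w r) * f w := by
  have hint : IntegrableOn f (Metric.ball w r) :=
    ((hf.continuousOn.mono hU).integrableOn_compact (isCompact_closedBall w r)).mono_set
      Metric.ball_subset_closedBall
  have hpre : (fun z : Cn d => w + z) ⁻¹' Metric.ball w r = Metric.ball 0 r := by
    ext z; simp
  have hmp : MeasurePreserving (fun z : Cn d => w + z) (volume.restrict (Metric.ball 0 r))
      (volume.restrict (Metric.ball w r)) := by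
    have := (measurePreserving_add_left (volume : Measure (Cn d)) w).restrict_preimage
      (s := Metric.ball w r) measurableSet_ball
    rwa [hpre] at this
  have hg : Integrable (fun z => f (w + z)) (volume.restrict (Metric.ball 0 r)) :=
    hmp.integrable_comp_of_integrable hint
  rw [← hmp.integral_comp (MeasurableEquiv.addLeft w).measurableEmbedding f,
    ← ((isCircular_volume d).restrict_ball r).integral_circleAverage hg]
  have : ∀ z ∈ Metric.ball (0 : Cn d) r,
      Real.circleAverage (fun t : ℂ => f (w + t • z)) 0 1 = f w := by
    intro z hz
    have hz : ‖z‖ < r := by simpa using hz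
    -- For `z = 0` the slice is constant and any radius above `1` serves; `2` is chosen.
    have hd := differentiableOn_slice (hf.mono (Metric.ball_subset_closedBall.trans hU))
      (z := z) (R := if ‖z‖ = 0 then 2 else r / ‖z‖)
      (by split_ifs with h
          · rw [h, mul_zero]; exact hr.le
          · rw [div_mul_cancel₀ _ h]) hr
    have h1 : 1 < if ‖z‖ = 0 then 2 else r / ‖z‖ := by
      split_ifs with h
      · norm_num
      · rwa [one_lt_div (lt_of_le_of_ne (norm_nonneg z) (Ne.symm h))]
    have := (hd.diffContOnCl_ball (c := 0) (R := |1|) (by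
      rw [abs_one]; exact Metric.closedBall_subset_ball h1)).circleAverage
    simpa using this
  rw [setIntegral_congr_fun measurableSet_ball this, setIntegral_const, Complex.real_smul]
  rw [Measure.real, Measure.real, Measure.addHaar_ball_center volume w r]

theorem cConst_pos {d : ℕ} {σ : ℝ} (h : (d : ℝ) < σ) : 0 < cConst d σ := by
  have h0 : 0 < σ := (Nat.cast_nonneg d).trans_lt h
  have := Real.Gamma_pos_of_pos h0
  have := Real.Gamma_pos_of_pos (sub_pos.2 h)
  have := Real.pi_pos
  unfold cConst
  positivity

/-- On `|z| ≤ R` the factor `(1-|z|²)^{-(d+1)}` is at least `1`, so the density of `μ_σ` is at least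
`δ = c_σ (1-R²)^σ > 0`. -/
theorem exists_restrict_closedBall_le_smul_bergmanMeasure {d : ℕ} {σ : ℝ} (h : (d : ℝ) < σ)
    {R : ℝ} (hR0 : 0 ≤ R) (hR : R < 1) :
    ∃ c : ℝ≥0∞, c ≠ ∞ ∧
      (volume : Measure (Cn d)).restrict (Metric.closedBall 0 R) ≤ c • bergmanMeasure d σ := by
  have h0 : 0 < σ := (Nat.cast_nonneg d).trans_lt h
  have hR2 : 0 < 1 - R ^ 2 := by nlinarith
  set δ : ℝ := cConst d σ * (1 - R ^ 2) ^ σ with hδ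
  have hδ0 : 0 < δ := mul_pos (cConst_pos h) (Real.rpow_pos_of_pos hR2 _)
  refine ⟨(ENNReal.ofReal δ)⁻¹, by simpa using hδ0, ?_⟩
  refine Measure.le_intro fun s hs _ => ?_
  rw [Measure.smul_apply, smul_eq_mul, bergmanMeasure, hypVolume,
    ← withDensity_mul _ (measurable_hypDensity d) (measurable_bergmanDensity d σ),
    withDensity_apply _ hs, Measure.restrict_restrict hs, Measure.restrict_apply hs]
  rw [← ENNReal.div_eq_inv_mul, ENNReal.le_div_iff_mul_le (by left; simpa using hδ0)
    (by left; simp), mul_comm]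
  have hK : MeasurableSet (s ∩ Metric.closedBall (0 : Cn d) R) :=
    hs.inter Metric.isClosed_closedBall.measurableSet
  calc ENNReal.ofReal δ * volume (s ∩ Metric.closedBall 0 R)
      = ∫⁻ _ in s ∩ Metric.closedBall (0 : Cn d) R, ENNReal.ofReal δ := by
        rw [setLIntegral_const]
    _ ≤ ∫⁻ z in s ∩ Metric.closedBall (0 : Cn d) R,
          ENNReal.ofReal (((1 - ‖z‖ ^ 2) ^ (d + 1))⁻¹) *
            ENNReal.ofReal (cConst d σ * (1 - ‖z‖ ^ 2) ^ σ) := by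
        refine setLIntegral_mono' hK fun z hz => ?_
        have hz : ‖z‖ ≤ R := by simpa using hz.2
        have hz2 : ‖z‖ ^ 2 ≤ R ^ 2 := by gcongr
        have h1 : 1 ≤ ((1 - ‖z‖ ^ 2) ^ (d + 1))⁻¹ := by
          rw [one_le_inv₀ (by apply pow_pos; linarith)]
          exact pow_le_one₀ (by linarith) (by nlinarith [norm_nonneg z])
        rw [← ENNReal.ofReal_mul (by linarith)]
        apply ENNReal.ofReal_le_ofReal
        calc δ ≤ 1 * (cConst d σ * (1 - ‖z‖ ^ 2) ^ σ) := by
              rw [one_mul]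
              have := cConst_pos h
              rw [hδ]; gcongr
          _ ≤ _ := by
              gcongr
              exact mul_nonneg (cConst_pos h).le (Real.rpow_nonneg (by linarith) _)
    _ ≤ _ := lintegral_mono_set
        (Set.inter_subset_inter_right s (Metric.closedBall_subset_ball hR))

/-- Point evaluations are bounded, uniformly on `|w| ≤ R`: average over the ball of radius `(1-R)/2`
about `w`, pass from `L¹` to `L²`, and compare Lebesgue measure with `μ_σ`. -/
theorem exists_norm_le_eLpNorm {d : ℕ} {σ : ℝ} (h : (d : ℝ) < σ) {R : ℝ} (hR0 : 0 ≤ R)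
    (hR : R < 1) :
    ∃ C : ℝ, 0 ≤ C ∧ ∀ f : Cn d → ℂ, DifferentiableOn ℂ f (unitBall d) →
      MemLp f 2 (bergmanMeasure d σ) → ∀ w ∈ Metric.closedBall (0 : Cn d) R,
        ‖f w‖ ≤ C * (eLpNorm f 2 (bergmanMeasure d σ)).toReal := by
  set r := (1 - R) / 2 with hr
  have hr0 : 0 < r := by rw [hr]; linarith
  obtain ⟨c, hc, hle⟩ := exists_restrict_closedBall_le_smul_bergmanMeasure (d := d) h
    (R := R + r) (by linarith) (by linarith)
  set V := (volume : Measure (Cn d)) (Metric.ball 0 r) with hV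
  have hV0 : V ≠ 0 := (Metric.measure_ball_pos _ _ hr0).ne'
  have hVt : V ≠ ∞ := measure_ball_lt_top.ne
  -- `c^{1/2}` comes from the comparison of measures, `V^{1/2}` from Cauchy-Schwarz on a ball of
  -- volume `V`.
  set K : ℝ≥0∞ := c ^ (1 / (2 : ℝ≥0∞)).toReal * V ^ (1 / (1 : ℝ≥0∞).toReal - 1 / (2 : ℝ≥0∞).toReal)
    with hKdef
  have hK : K ≠ ∞ := by
    refine ENNReal.mul_ne_top (ENNReal.rpow_ne_top_of_nonneg (by positivity) hc)
      (ENNReal.rpow_ne_top_of_nonneg (by norm_num) hVt)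
  refine ⟨K.toReal / V.toReal, by positivity, fun f hf hfm w hw => ?_⟩
  have hw : ‖w‖ ≤ R := by simpa using hw
  have hsub : Metric.closedBall w r ⊆ Metric.closedBall 0 (R + r) :=
    Metric.closedBall_subset_closedBall' (by rw [dist_zero_right]; linarith)
  have hsub1 : Metric.closedBall (0 : Cn d) (R + r) ⊆ unitBall d :=
    Metric.closedBall_subset_ball (by linarith)
  have hmean := setIntegral_ball_of_differentiableOn hr0 (hsub.trans hsub1) hf
  have hVw : volume (Metric.ball w r) = V := Measure.addHaar_ball_center _ _ _
  have hmeas : volume.restrict (Metric.ball w r) ≤ c • bergmanMeasure d σ :=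
    (Measure.restrict_mono_set _ (Metric.ball_subset_closedBall.trans hsub)).trans hle
  have h1 : eLpNorm f 1 (volume.restrict (Metric.ball w r)) ≤
      K * eLpNorm f 2 (bergmanMeasure d σ) := by
    have hfr : MemLp f 2 (volume.restrict (Metric.ball w r)) := hfm.of_measure_le_smul hc hmeas
    refine (eLpNorm_le_eLpNorm_mul_rpow_measure_univ (p := 1) (q := 2) one_le_two hfr.1).trans ?_
    rw [Measure.restrict_apply_univ, hVw, hKdef, mul_right_comm]
    gcongr
    simpa [smul_eq_mul] using eLpNorm_le_of_measure_le_smul hmeas (f := f) (p := 2)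
  have h2 : ENNReal.ofReal (V.toReal * ‖f w‖) ≤ K * eLpNorm f 2 (bergmanMeasure d σ) := by
    refine le_trans ?_ h1
    rw [eLpNorm_one_eq_lintegral_enorm]
    refine le_trans ?_ (enorm_integral_le_lintegral_enorm f)
    rw [hmean, ← ofReal_norm, norm_mul, Complex.norm_real, Measure.real, hVw]
    simp
  have h3 := (ENNReal.ofReal_le_iff_le_toReal (ENNReal.mul_ne_top hK hfm.2.ne)).1 h2
  rw [ENNReal.toReal_mul] at h3
  rw [div_mul_eq_mul_div, le_div_iff₀ (ENNReal.toReal_pos hV0 hVt)]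
  linarith

/-! ### Limits of holomorphic functions in `L²` -/

/-- Cauchy's estimate on each complex line through `w`, on a circle at distance `r/2` from `w`. -/
theorem norm_fderiv_le_of_forall_mem_ball {d : ℕ} {f : Cn d → ℂ} {w : Cn d} {r M : ℝ} (hr : 0 < r)
    (hf : DifferentiableOn ℂ f (Metric.ball w r)) (hM : ∀ z ∈ Metric.ball w r, ‖f z‖ ≤ M) :
    ‖fderiv ℂ f w‖ ≤ 2 / r * M := by
  have hM0 : 0 ≤ M := (norm_nonneg _).trans (hM w (Metric.mem_ball_self hr))
  refine ContinuousLinearMap.opNorm_le_bound _ (by positivity) fun v => ?_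
  rcases (norm_nonneg v).eq_or_lt with hv | hv
  · rw [norm_eq_zero.1 hv.symm]; simp
  have hd := differentiableOn_slice hf (z := v) (R := r / ‖v‖) (by rw [div_mul_cancel₀ _ hv.ne']) hr
  have hR : 0 < r / 2 / ‖v‖ := by positivity
  have hRlt : r / 2 / ‖v‖ < r / ‖v‖ := by gcongr; linarith
  have hder : deriv (fun t : ℂ => f (w + t • v)) 0 = fderiv ℂ f w v := by
    have h1 : HasDerivAt (fun t : ℂ => w + t • v) v 0 := by
      simpa using ((hasDerivAt_id (0 : ℂ)).smul_const v).const_add w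
    have h2 : HasFDerivAt f (fderiv ℂ f w) (w + (0 : ℂ) • v) := by
      rw [zero_smul, add_zero]
      exact (hf.differentiableAt (Metric.ball_mem_nhds w hr)).hasFDerivAt
    exact (h2.comp_hasDerivAt (0 : ℂ) h1).deriv
  rw [← hder]
  refine (Complex.norm_deriv_le_of_forall_mem_sphere_norm_le hR
    (hd.diffContOnCl_ball (Metric.closedBall_subset_ball hRlt)) (C := M) fun t ht => hM _ ?_).trans
    (le_of_eq ?_)
  · have ht : ‖t‖ = r / 2 / ‖v‖ := by simpa using ht
    rw [Metric.mem_ball, dist_self_add_left, norm_smul, ht, div_mul_cancel₀ _ hv.ne']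
    linarith
  · field_simp

/-- The local bounds turn `L²` convergence into locally uniform convergence of the functions and
their derivatives, so the pointwise limit is holomorphic. It represents `G` because a subsequence
also converges to `G` almost everywhere. -/
theorem exists_differentiableOn_limit {d : ℕ} {σ : ℝ} (h : (d : ℝ) < σ) {f : ℕ → Cn d → ℂ}
    (hf : ∀ i, DifferentiableOn ℂ (f i) (unitBall d))
    (hL : ∀ i, MemLp (f i) 2 (bergmanMeasure d σ)) {G : Lp ℂ 2 (bergmanMeasure d σ)}
    (hG : Tendsto (fun i => (hL i).toLp (f i)) atTop (𝓝 G)) :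
    ∃ g : Cn d → ℂ, DifferentiableOn ℂ g (unitBall d) ∧ G =ᵐ[bergmanMeasure d σ] g ∧
      ∀ z ∈ unitBall d, Tendsto (fun i => f i z) atTop (𝓝 (g z)) ∧
        Tendsto (fun i => fderiv ℂ (f i) z) atTop (𝓝 (fderiv ℂ g z)) := by
  have hLp : ∀ i j, (eLpNorm (f i - f j) 2 (bergmanMeasure d σ)).toReal =
      dist ((hL i).toLp (f i)) ((hL j).toLp (f j)) := by
    intro i j
    rw [dist_eq_norm, ← MemLp.toLp_sub, Lp.norm_toLp]
  have hcs := hG.cauchySeq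
  -- Dividing by `C + 1` instead of `C` covers `C = 0`.
  have cauchy_of_bound : ∀ {X : Type} [NormedAddCommGroup X] (u : ℕ → Cn d → X)
      (s : Set (Cn d)) (C : ℝ), 0 ≤ C → (∀ i j, ∀ z ∈ s, ‖u i z - u j z‖ ≤
        C * dist ((hL i).toLp (f i)) ((hL j).toLp (f j))) → UniformCauchySeqOn u atTop s := by
    intro X _ u s C hC hu
    rw [Metric.uniformCauchySeqOn_iff]
    intro ε hε
    obtain ⟨N, hN⟩ := Metric.cauchySeq_iff.1 hcs (ε / (C + 1)) (by positivity)
    refine ⟨N, fun i hi j hj z hz => ?_⟩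
    rw [dist_eq_norm]
    calc ‖u i z - u j z‖ ≤ C * dist ((hL i).toLp (f i)) ((hL j).toLp (f j)) := hu i j z hz
      _ ≤ (C + 1) * dist ((hL i).toLp (f i)) ((hL j).toLp (f j)) := by gcongr; linarith
      _ < (C + 1) * (ε / (C + 1)) := by gcongr; exact hN i hi j hj
      _ = ε := by field_simp
  have hu0 : ∀ R, 0 ≤ R → R < 1 → UniformCauchySeqOn f atTop (Metric.closedBall 0 R) := by
    intro R h0 h1
    obtain ⟨C, hC, hb⟩ := exists_norm_le_eLpNorm (d := d) h h0 h1
    refine cauchy_of_bound f _ C hC fun i j z hz => ?_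
    rw [← hLp]
    exact hb _ ((hf i).sub (hf j)) ((hL i).sub (hL j)) z hz
  have hu1 : ∀ R, 0 ≤ R → R < 1 →
      UniformCauchySeqOn (fun i => fderiv ℂ (f i)) atTop (Metric.closedBall 0 R) := by
    intro R h0 h1
    obtain ⟨C, hC, hb⟩ := exists_norm_le_eLpNorm (d := d) h (R := R + (1 - R) / 2)
      (by linarith) (by linarith)
    have hr : 0 < (1 - R) / 2 := by linarith
    refine cauchy_of_bound _ _ (2 / ((1 - R) / 2) * C) (by positivity) fun i j z hz => ?_
    have hz' : ‖z‖ ≤ R := by simpa using hz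
    have hsub : Metric.ball z ((1 - R) / 2) ⊆ Metric.closedBall 0 (R + (1 - R) / 2) :=
      Metric.ball_subset_closedBall.trans
        (Metric.closedBall_subset_closedBall' (by rw [dist_zero_right]; linarith))
    have hsub' : Metric.ball z ((1 - R) / 2) ⊆ unitBall d :=
      hsub.trans (Metric.closedBall_subset_ball (by linarith))
    have hzn := Metric.isOpen_ball.mem_nhds (hsub' (Metric.mem_ball_self hr))
    rw [← fderiv_sub ((hf i).differentiableAt hzn) ((hf j).differentiableAt hzn), mul_assoc, ← hLp]
    exact norm_fderiv_le_of_forall_mem_ball hr (((hf i).sub (hf j)).mono hsub') fun w hw =>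
      hb _ ((hf i).sub (hf j)) ((hL i).sub (hL j)) w (hsub hw)
  have hR : ∀ z ∈ unitBall d, ∃ R, 0 ≤ R ∧ R < 1 ∧ z ∈ Metric.ball 0 R := by
    intro z hz
    have hz : ‖z‖ < 1 := by simpa using hz
    exact ⟨(‖z‖ + 1) / 2, by positivity, by linarith, by rw [mem_ball_zero_iff]; linarith⟩
  have hlim0 : ∀ z, ∃ a, z ∈ unitBall d → Tendsto (fun i => f i z) atTop (𝓝 a) := by
    intro z
    by_cases hz : z ∈ unitBall d
    · obtain ⟨R, h0, h1, hzR⟩ := hR z hz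
      obtain ⟨a, ha⟩ := cauchySeq_tendsto_of_complete
        ((hu0 R h0 h1).cauchySeq (Metric.ball_subset_closedBall hzR))
      exact ⟨a, fun _ => ha⟩
    · exact ⟨0, fun h => absurd h hz⟩
  have hlim1 : ∀ z, ∃ a, z ∈ unitBall d → Tendsto (fun i => fderiv ℂ (f i) z) atTop (𝓝 a) := by
    intro z
    by_cases hz : z ∈ unitBall d
    · obtain ⟨R, h0, h1, hzR⟩ := hR z hz
      obtain ⟨a, ha⟩ := cauchySeq_tendsto_of_complete
        ((hu1 R h0 h1).cauchySeq (Metric.ball_subset_closedBall hzR))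
      exact ⟨a, fun _ => ha⟩
    · exact ⟨0, fun h => absurd h hz⟩
  choose g hg using hlim0
  choose g' hg' using hlim1
  have hder : ∀ z ∈ unitBall d, HasFDerivAt g (g' z) z := by
    intro z hz
    obtain ⟨R, h0, h1, hzR⟩ := hR z hz
    have hsub : Metric.ball (0 : Cn d) R ⊆ unitBall d := Metric.ball_subset_ball h1.le
    refine hasFDerivAt_of_tendstoUniformlyOn (l := atTop) (f := f) (f' := fun i => fderiv ℂ (f i))
      Metric.isOpen_ball (((hu1 R h0 h1).mono
        Metric.ball_subset_closedBall).tendstoUniformlyOn_of_tendsto fun w hw => hg' w (hsub hw))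
      (fun i w hw => ((hf i).differentiableAt
        (Metric.isOpen_ball.mem_nhds (hsub hw))).hasFDerivAt) (fun w hw => hg w (hsub hw)) hzR
  refine ⟨g, fun z hz => (hder z hz).differentiableAt.differentiableWithinAt, ?_,
    fun z hz => ⟨hg z hz, ?_⟩⟩
  · obtain ⟨ns, hns, hae⟩ := (tendstoInMeasure_of_tendsto_Lp hG).exists_seq_tendsto_ae
    have hall : ∀ᵐ z ∂bergmanMeasure d σ, ∀ i, (hL i).toLp (f i) z = f i z :=
      ae_all_iff.2 fun i => (hL i).coeFn_toLp
    filter_upwards [hae, hall, ae_mem_unitBall d σ] with z h1 h2 hz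
    simp only [h2] at h1
    exact tendsto_nhds_unique h1 ((hg z hz).comp hns.tendsto_atTop)
  · rw [(hder z hz).fderiv]
    exact hg' z hz

/-! ### Toeplitz operators on Bergman spaces -/

theorem isClosed_bergman {d : ℕ} {σ : ℝ} (h : (d : ℝ) < σ) :
    IsClosed (bergman d σ : Set (Lp ℂ 2 (bergmanMeasure d σ))) := by
  refine IsSeqClosed.isClosed fun F G hF hG => ?_
  choose f hf hFf using hF
  have hL : ∀ i, MemLp (f i) 2 (bergmanMeasure d σ) := fun i =>
    (memLp_congr_ae (hFf i)).1 (Lp.memLp (F i))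
  have e : ∀ i, (hL i).toLp (f i) = F i := fun i =>
    Lp.ext ((hL i).coeFn_toLp.trans (hFf i).symm)
  obtain ⟨g, hg, hGg, -⟩ := exists_differentiableOn_limit h hf hL (G := G) (by simpa only [e] using hG)
  exact ⟨g, hg, hGg⟩

theorem bergman_hasOrthogonalProjection {d : ℕ} {σ : ℝ} (h : (d : ℝ) < σ) :
    (bergman d σ).HasOrthogonalProjection := by
  have : CompleteSpace (bergman d σ) := (isClosed_bergman h).completeSpace_coe
  infer_instance

theorem norm_le_supOnBall {d : ℕ} {φ : Cn d → ℂ} (hb : BddOnBall φ) {z : Cn d}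
    (hz : z ∈ unitBall d) : ‖φ z‖ ≤ supOnBall φ := by
  obtain ⟨C, hC⟩ := hb
  exact le_ciSup (f := fun z : unitBall d => ‖φ z‖) ⟨C, by rintro _ ⟨w, rfl⟩; exact hC w w.2⟩ ⟨z, hz⟩

theorem supOnBall_nonneg {d : ℕ} (φ : Cn d → ℂ) : 0 ≤ supOnBall φ :=
  Real.iSup_nonneg fun _ => norm_nonneg _

theorem coeFn_mulOp {d : ℕ} (σ : ℝ) {φ : Cn d → ℂ} (hm : Measurable φ) (hb : BddOnBall φ)
    (F : Lp ℂ 2 (bergmanMeasure d σ)) :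
    mulOp σ hm hb F =ᵐ[bergmanMeasure d σ] fun z => φ z * F z := by
  have h1 := ContinuousLinearMap.coeFn_holder (ContinuousLinearMap.mul ℂ ℂ) (r := 2)
    ((memLp_top σ hm hb).toLp φ) F
  have h2 := (memLp_top σ hm hb).coeFn_toLp
  filter_upwards [h1, h2] with z h1 h2
  rw [← h2]
  exact h1

theorem norm_toeplitz_le {d : ℕ} (σ : ℝ) [(bergman d σ).HasOrthogonalProjection]
    {φ : Cn d → ℂ} (hm : Measurable φ) (hb : BddOnBall φ) :
    ‖toeplitz σ hm hb‖ ≤ supOnBall φ := by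
  refine ContinuousLinearMap.opNorm_le_bound _ (supOnBall_nonneg φ) fun f => ?_
  refine ((bergman d σ).norm_orthogonalProjectionOnto_apply_le _).trans ?_
  refine Lp.norm_le_mul_norm_of_ae_le_mul ?_
  filter_upwards [coeFn_mulOp σ hm hb f, ae_mem_unitBall d σ] with z h1 hz
  refine (congrArg norm h1).trans_le ?_
  rw [norm_mul]
  exact mul_le_mul_of_nonneg_right (norm_le_supOnBall hb hz) (norm_nonneg _)

theorem inner_toeplitz {d : ℕ} (σ : ℝ) [(bergman d σ).HasOrthogonalProjection]
    {φ : Cn d → ℂ} (hm : Measurable φ) (hb : BddOnBall φ) (f g : bergman d σ) :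
    inner ℂ (toeplitz σ hm hb f) g =
      ∫ z, conj (φ z) * inner ℂ ((f : Lp ℂ 2 (bergmanMeasure d σ)) z)
        ((g : Lp ℂ 2 (bergmanMeasure d σ)) z) ∂bergmanMeasure d σ := by
  have : inner ℂ (toeplitz σ hm hb f) g =
      inner ℂ (mulOp σ hm hb f) (g : Lp ℂ 2 (bergmanMeasure d σ)) :=
    Submodule.inner_orthogonalProjectionOnto_eq_of_mem_right g _
  rw [this, L2.inner_def]
  refine integral_congr_ae ?_
  filter_upwards [coeFn_mulOp σ hm hb f] with z h1
  rw [h1]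
  simp only [RCLike.inner_apply, map_mul]
  ring

theorem isPositive_toeplitz {d : ℕ} (σ : ℝ) [(bergman d σ).HasOrthogonalProjection]
    {φ : Cn d → ℂ} (hm : Measurable φ) (hb : BddOnBall φ)
    (hφ : ∀ z ∈ unitBall d, 0 ≤ (φ z).re ∧ (φ z).im = 0) :
    (toeplitz σ hm hb).IsPositive := by
  rw [ContinuousLinearMap.isPositive_def]
  constructor
  · intro f g
    change inner ℂ (toeplitz σ hm hb f) g = inner ℂ f (toeplitz σ hm hb g)
    rw [← inner_conj_symm f, inner_toeplitz, inner_toeplitz, ← integral_conj]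
    refine integral_congr_ae ?_
    filter_upwards [ae_mem_unitBall d σ] with z hz
    rw [map_mul, inner_conj_symm, Complex.conj_conj, Complex.conj_eq_iff_im.2 (hφ z hz).2]
  · intro f
    rw [ContinuousLinearMap.reApplyInnerSelf, inner_toeplitz]
    have : ∫ z, conj (φ z) * inner ℂ ((f : Lp ℂ 2 (bergmanMeasure d σ)) z)
        ((f : Lp ℂ 2 (bergmanMeasure d σ)) z) ∂bergmanMeasure d σ =
        ∫ z, (((φ z).re * ‖(f : Lp ℂ 2 (bergmanMeasure d σ)) z‖ ^ 2 : ℝ) : ℂ)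
          ∂bergmanMeasure d σ := by
      refine integral_congr_ae ?_
      filter_upwards [ae_mem_unitBall d σ] with z hz
      rw [Complex.conj_eq_iff_im.2 (hφ z hz).2, inner_self_eq_norm_sq_to_K, Complex.ofReal_mul,
        Complex.ofReal_pow]
      congr 1
      exact Complex.ext rfl (by simp [(hφ z hz).2])
    rw [this, integral_complex_ofReal]
    change 0 ≤ (_ : ℝ)
    refine integral_nonneg_of_ae ?_
    filter_upwards [ae_mem_unitBall d σ] with z hz
    exact mul_nonneg (hφ z hz).1 (by positivity)

/-! ### Radial integrals -/

/-- From `1 - r² = (1-r)(1+r)`, the only singular factor is `(1-r)^{s-1}`, integrable for `s > 0`.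
-/
theorem intervalIntegrable_pow_mul_one_sub_sq_rpow {s : ℝ} (hs : 0 < s) (m : ℕ) :
    IntervalIntegrable (fun r : ℝ => r ^ m * (1 - r ^ 2) ^ (s - 1)) volume 0 1 := by
  have h1 : IntervalIntegrable (fun r : ℝ => (1 - r) ^ (s - 1)) volume 0 1 := by
    have := (intervalIntegral.intervalIntegrable_rpow' (a := 0) (b := 1)
      (r := s - 1) (by linarith)).comp_sub_left 1
    simpa using this.symm
  have h2 : ContinuousOn (fun r : ℝ => r ^ m * (1 + r) ^ (s - 1)) (Set.uIcc 0 1) := by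
    rw [Set.uIcc_of_le zero_le_one]
    refine ContinuousOn.mul (by fun_prop) (ContinuousOn.rpow_const (by fun_prop) ?_)
    intro r hr
    left
    linarith [hr.1]
  refine (h1.mul_continuousOn h2).congr fun r hr => ?_
  rw [Set.uIoc_of_le zero_le_one] at hr
  have : (1 - r ^ 2) = (1 - r) * (1 + r) := by ring
  rw [this, Real.mul_rpow (by linarith [hr.2]) (by linarith [hr.1])]
  ring

/-- Integrate the derivative of `r^{m+1} (1-r²)^s`, which vanishes at both ends. -/
theorem integral_pow_mul_one_sub_sq_rpow {s : ℝ} (hs : 0 < s) (m : ℕ) :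
    (m + 1 + 2 * s) * ∫ r in (0 : ℝ)..1, r ^ (m + 2) * (1 - r ^ 2) ^ (s - 1) =
      (m + 1) * ∫ r in (0 : ℝ)..1, r ^ m * (1 - r ^ 2) ^ (s - 1) := by
  have i1 := intervalIntegrable_pow_mul_one_sub_sq_rpow hs m
  have i2 := intervalIntegrable_pow_mul_one_sub_sq_rpow hs (m + 2)
  have key := intervalIntegral.integral_eq_sub_of_hasDerivAt_of_le (a := 0) (b := 1)
    (f := fun r : ℝ => r ^ (m + 1) * (1 - r ^ 2) ^ s)
    (f' := fun r : ℝ => (m + 1) * (r ^ m * (1 - r ^ 2) ^ (s - 1)) -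
      (m + 1 + 2 * s) * (r ^ (m + 2) * (1 - r ^ 2) ^ (s - 1))) zero_le_one
    (ContinuousOn.mul (by fun_prop) (ContinuousOn.rpow_const (by fun_prop) fun _ _ => Or.inr hs.le))
    (fun r hr => by
      have hpos : 0 < 1 - r ^ 2 := by nlinarith [hr.1, hr.2]
      have h1 : HasDerivAt (fun r : ℝ => 1 - r ^ 2) (-(2 * r)) r := by
        simpa using (hasDerivAt_pow 2 r).const_sub 1
      have h2 := (hasDerivAt_pow (m + 1) r).mul (h1.rpow_const (p := s) (Or.inl hpos.ne'))
      refine h2.congr_deriv ?_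
      have : (1 - r ^ 2) ^ s = (1 - r ^ 2) ^ (s - 1) * (1 - r ^ 2) := by
        rw [← Real.rpow_add_one hpos.ne', sub_add_cancel]
      rw [this]
      simp only [Nat.add_sub_cancel]
      push_cast
      ring)
    ((i1.const_mul _).sub (i2.const_mul _))
  rw [intervalIntegral.integral_sub (i1.const_mul _) (i2.const_mul _),
    intervalIntegral.integral_const_mul, intervalIntegral.integral_const_mul] at key
  simp [hs.ne'] at key
  linarith

/-- The density of `μ_σ` with respect to Lebesgue measure, as a function of `r = |z|`. -/
noncomputable def radialDensity (d : ℕ) (σ r : ℝ) : ℝ :=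
  (Set.Iio 1).indicator (fun r => ((1 - r ^ 2) ^ (d + 1))⁻¹ * (cConst d σ * (1 - r ^ 2) ^ σ)) r

theorem measurable_radialDensity (d : ℕ) (σ : ℝ) : Measurable (radialDensity d σ) :=
  Measurable.indicator (by fun_prop) measurableSet_Iio

theorem radialDensity_nonneg {d : ℕ} {σ : ℝ} (h : (d : ℝ) < σ) {r : ℝ} (hr : 0 ≤ r) :
    0 ≤ radialDensity d σ r := by
  refine Set.indicator_apply_nonneg fun hr1 => ?_
  have hr1 : r < 1 := hr1
  have : 0 ≤ 1 - r ^ 2 := by nlinarith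
  have := (cConst_pos h).le
  positivity

theorem bergmanMeasure_eq_withDensity (d : ℕ) (σ : ℝ) :
    bergmanMeasure d σ =
      (volume : Measure (Cn d)).withDensity fun z => ENNReal.ofReal (radialDensity d σ ‖z‖) := by
  rw [bergmanMeasure, hypVolume,
    ← withDensity_mul _ (measurable_hypDensity d) (measurable_bergmanDensity d σ),
    ← withDensity_indicator measurableSet_ball]
  congr 1
  funext z
  by_cases hz : z ∈ unitBall d
  · have hz1 : ‖z‖ < 1 := by simpa using hz
    have : 0 ≤ 1 - ‖z‖ ^ 2 := by nlinarith [norm_nonneg z]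
    rw [Set.indicator_of_mem hz, radialDensity, Set.indicator_of_mem (show ‖z‖ ∈ Set.Iio 1 from hz1),
      Pi.mul_apply,
      ENNReal.ofReal_mul (inv_nonneg.2 (pow_nonneg this _))]
  · have hz1 : ¬ ‖z‖ < 1 := by simpa using hz
    rw [Set.indicator_of_notMem hz, radialDensity,
      Set.indicator_of_notMem (show ‖z‖ ∉ Set.Iio 1 from hz1), ENNReal.ofReal_zero]

theorem radialDensity_mul_eq {d : ℕ} {σ : ℝ} (m : ℕ) {r : ℝ} (hr : r ∈ Set.Ioo (0 : ℝ) 1) :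
    r ^ m * radialDensity d σ r = cConst d σ * (r ^ m * (1 - r ^ 2) ^ (σ - d - 1)) := by
  have hpos : 0 < 1 - r ^ 2 := by nlinarith [hr.1, hr.2]
  rw [radialDensity, Set.indicator_of_mem (show r ∈ Set.Iio 1 from hr.2),
    show σ - d - 1 = σ - ((d + 1 : ℕ) : ℝ) by push_cast; ring, Real.rpow_sub_natCast hpos.ne']
  field_simp

theorem integral_Ioi_radialDensity {d : ℕ} {σ : ℝ} (m : ℕ) :
    ∫ r in Set.Ioi (0 : ℝ), r ^ m * radialDensity d σ r =
      cConst d σ * ∫ r in (0 : ℝ)..1, r ^ m * (1 - r ^ 2) ^ (σ - d - 1) := by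
  rw [intervalIntegral.integral_of_le zero_le_one, integral_Ioc_eq_integral_Ioo,
    ← integral_const_mul, ← setIntegral_congr_fun measurableSet_Ioo
      fun r hr => radialDensity_mul_eq (d := d) (σ := σ) m hr]
  refine setIntegral_eq_of_subset_of_forall_sdiff_eq_zero measurableSet_Ioi
    Set.Ioo_subset_Ioi_self fun r hr => ?_
  have : r ∉ Set.Iio (1 : ℝ) := fun h => hr.2 ⟨hr.1, h⟩
  rw [radialDensity, Set.indicator_of_notMem this, mul_zero]

theorem integrableOn_Ioi_radialDensity {d : ℕ} {σ : ℝ} (h : (d : ℝ) < σ) (m : ℕ) :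
    IntegrableOn (fun r => r ^ m * radialDensity d σ r) (Set.Ioi (0 : ℝ)) := by
  have h1 : IntegrableOn (fun r => r ^ m * radialDensity d σ r) (Set.Ioo (0 : ℝ) 1) := by
    rw [integrableOn_congr_fun (fun r hr => radialDensity_mul_eq (d := d) (σ := σ) m hr)
      measurableSet_Ioo]
    exact (((intervalIntegrable_iff_integrableOn_Ioo_of_le zero_le_one).1
      (intervalIntegrable_pow_mul_one_sub_sq_rpow (sub_pos.2 h) m)).const_mul _)
  refine h1.of_forall_sdiff_eq_zero measurableSet_Ioi fun r hr => ?_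
  have : r ∉ Set.Iio (1 : ℝ) := fun h => hr.2 ⟨hr.1, h⟩
  rw [radialDensity, Set.indicator_of_notMem this, mul_zero]

theorem finrank_real_Cn (d : ℕ) : Module.finrank ℝ (Cn d) = 2 * d := by
  rw [finrank_real_of_complex, finrank_euclideanSpace, Fintype.card_fin]

theorem nontrivial_Cn {d : ℕ} (hd : 0 < d) : Nontrivial (Cn d) :=
  Module.nontrivial_of_finrank_pos (R := ℝ) (by rw [finrank_real_Cn]; omega)

theorem isFiniteMeasure_bergmanMeasure {d : ℕ} (hd : 0 < d) {σ : ℝ} (h : (d : ℝ) < σ) :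
    IsFiniteMeasure (bergmanMeasure d σ) := by
  have := nontrivial_Cn hd
  rw [bergmanMeasure_eq_withDensity]
  refine isFiniteMeasure_withDensity_ofReal ?_
  refine Integrable.hasFiniteIntegral ?_
  rw [integrable_fun_norm_addHaar (volume : Measure (Cn d)) (f := radialDensity d σ)]
  simpa only [smul_eq_mul] using integrableOn_Ioi_radialDensity h _

/-- In polar coordinates this is the radial recursion with `m = 2d-1+2k` and `s = σ-d`: then `m+1+2s
= 2(σ+k)` and `m+1 = 2(d+k)`. -/
theorem integral_norm_pow_bergmanMeasure {d : ℕ} (hd : 0 < d) {σ : ℝ} (h : (d : ℝ) < σ) (k : ℕ) :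
    (σ + k) * ∫ z, ‖z‖ ^ (2 * (k + 1)) ∂bergmanMeasure d σ =
      (d + k) * ∫ z, ‖z‖ ^ (2 * k) ∂bergmanMeasure d σ := by
  have := nontrivial_Cn hd
  have key : ∀ k : ℕ, ∫ z, ‖z‖ ^ (2 * k) ∂bergmanMeasure d σ =
      (2 * d : ℕ) • (volume.real (Metric.ball (0 : Cn d) 1)) • (cConst d σ *
        ∫ r in (0 : ℝ)..1, r ^ (2 * d - 1 + 2 * k) * (1 - r ^ 2) ^ (σ - d - 1)) := by
    intro k
    have hm : Measurable fun z : Cn d => ENNReal.ofReal (radialDensity d σ ‖z‖) :=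
      ((measurable_radialDensity d σ).comp measurable_norm).ennreal_ofReal
    rw [bergmanMeasure_eq_withDensity, integral_withDensity_eq_integral_toReal_smul hm
      (ae_of_all _ fun _ => ENNReal.ofReal_lt_top)]
    have e : ∀ z : Cn d, (ENNReal.ofReal (radialDensity d σ ‖z‖)).toReal • ‖z‖ ^ (2 * k) =
        (fun r => radialDensity d σ r * r ^ (2 * k)) ‖z‖ := fun z => by
      rw [ENNReal.toReal_ofReal (radialDensity_nonneg h (norm_nonneg z)), smul_eq_mul]
    simp only [e]
    rw [integral_fun_norm_addHaar (volume : Measure (Cn d))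
      (fun r => radialDensity d σ r * r ^ (2 * k)), finrank_real_Cn, ← integral_Ioi_radialDensity]
    congr 2
    refine integral_congr_ae (ae_of_all _ fun r => ?_)
    simp only [smul_eq_mul, pow_add]
    ring
  rw [key, key]
  have rec1 := integral_pow_mul_one_sub_sq_rpow (sub_pos.2 h) (2 * d - 1 + 2 * k)
  have e1 : 2 * d - 1 + 2 * (k + 1) = 2 * d - 1 + 2 * k + 2 := by ring
  have e2 : ((2 * d - 1 + 2 * k : ℕ) : ℝ) = 2 * d + 2 * k - 1 := by
    have : ((2 * d - 1 + 2 * k : ℕ) : ℝ) + 1 = 2 * d + 2 * k := by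
      have : 2 * d - 1 + 2 * k + 1 = 2 * d + 2 * k := by omega
      exact_mod_cast this
    linarith
  rw [e2] at rec1
  rw [e1]
  have rec2 : (σ + k) * ∫ r in (0 : ℝ)..1, r ^ (2 * d - 1 + 2 * k + 2) *
      (1 - r ^ 2) ^ (σ - d - 1) =
      (d + k) * ∫ r in (0 : ℝ)..1, r ^ (2 * d - 1 + 2 * k) * (1 - r ^ 2) ^ (σ - d - 1) := by
    linarith
  simp only [nsmul_eq_mul, smul_eq_mul]
  linear_combination (((2 * d : ℕ) : ℝ) * volume.real (Metric.ball (0 : Cn d) 1) * cConst d σ) * rec2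

/-! ### Symmetry and positivity of the number operator -/

/-- Since `|z| < 1`, the slice `t ↦ f (t z)` extends past the closed unit disc, and on it `N` acts
as `t d/dt`. This reduces statements about `N` to one variable; `R` does not depend on `f`. -/
theorem exists_one_lt_slice {d : ℕ} {z : Cn d} (hz : z ∈ unitBall d) :
    ∃ R : ℝ, 1 < R ∧ ∀ f : Cn d → ℂ, DifferentiableOn ℂ f (unitBall d) →
      DifferentiableOn ℂ (fun t : ℂ => f (t • z)) (Metric.ball 0 R) ∧
      ∀ t ∈ Metric.ball (0 : ℂ) R, t * deriv (fun t : ℂ => f (t • z)) t = numOp f (t • z) := by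
  have hz1 : ‖z‖ < 1 := by simpa using hz
  refine ⟨if ‖z‖ = 0 then 2 else 1 / ‖z‖, ?_, fun f hf => ⟨?_, fun t ht => ?_⟩⟩
  · split_ifs with h
    · norm_num
    · rwa [one_lt_div (lt_of_le_of_ne (norm_nonneg z) (Ne.symm h))]
  · have := differentiableOn_slice (w := 0) (z := z) hf
      (R := if ‖z‖ = 0 then 2 else 1 / ‖z‖) (by
        split_ifs with h
        · rw [h, mul_zero]; exact zero_le_one
        · rw [div_mul_cancel₀ _ h]) one_pos
    simpa using this
  · have hmem : t • z ∈ unitBall d := by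
      rw [mem_ball_zero_iff, norm_smul]
      rw [mem_ball_zero_iff] at ht
      split_ifs at ht with h
      · rw [h, mul_zero]; exact one_pos
      · rwa [lt_div_iff₀ (lt_of_le_of_ne (norm_nonneg z) (Ne.symm h))] at ht
    have h1 : HasDerivAt (fun t : ℂ => t • z) z t := by
      simpa using (hasDerivAt_id t).smul_const z
    have h2 := (hf.differentiableAt (Metric.isOpen_ball.mem_nhds hmem)).hasFDerivAt
    have h3 : deriv (fun t : ℂ => f (t • z)) t = fderiv ℂ f (t • z) z :=
      (h2.comp_hasDerivAt t h1).deriv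
    rw [h3, numOp, map_smul, smul_eq_mul]

theorem integrable_conj_mul {d : ℕ} {μ : Measure (Cn d)} {f g : Cn d → ℂ} (hf : MemLp f 2 μ)
    (hg : MemLp g 2 μ) : Integrable (fun z => conj (f z) * g z) μ :=
  hf.star.integrable_mul hg

theorem integral_conj_numOp_mul {d : ℕ} {σ : ℝ} {f g : Cn d → ℂ}
    (hf : DifferentiableOn ℂ f (unitBall d)) (hg : DifferentiableOn ℂ g (unitBall d))
    (hf2 : MemLp f 2 (bergmanMeasure d σ)) (hg2 : MemLp g 2 (bergmanMeasure d σ))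
    (hNf : MemLp (numOp f) 2 (bergmanMeasure d σ)) (hNg : MemLp (numOp g) 2 (bergmanMeasure d σ)) :
    ∫ z, conj (numOp f z) * g z ∂bergmanMeasure d σ =
      ∫ z, conj (f z) * numOp g z ∂bergmanMeasure d σ := by
  have hc := isCircular_bergmanMeasure d σ
  rw [← hc.integral_circleAverage (integrable_conj_mul hNf hg2),
    ← hc.integral_circleAverage (integrable_conj_mul hf2 hNg)]
  refine integral_congr_ae ?_
  filter_upwards [ae_mem_unitBall d σ] with z hz
  obtain ⟨R, hR, hs⟩ := exists_one_lt_slice hz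
  have hsub : Metric.sphere (0 : ℂ) 1 ⊆ Metric.ball 0 R :=
    Metric.sphere_subset_closedBall.trans (Metric.closedBall_subset_ball hR)
  have key := circleAverage_conj_mul_deriv Metric.isOpen_ball hsub (hs f hf).1 (hs g hg).1
  rw [← abs_one (α := ℝ)] at hsub
  rw [Real.circleAverage_congr_sphere (f₂ := fun t : ℂ => conj (numOp f (t • z)) * g (t • z))
      fun t ht => by simp only [(hs f hf).2 t (hsub ht)],
    Real.circleAverage_congr_sphere (f₁ := fun t : ℂ => conj (f (t • z)) * _)
      (f₂ := fun t : ℂ => conj (f (t • z)) * numOp g (t • z))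
      fun t ht => by simp only [(hs g hg).2 t (hsub ht)]] at key
  exact key

theorem integral_conj_mul_numOp_nonneg {d : ℕ} {σ : ℝ} {f : Cn d → ℂ}
    (hf : DifferentiableOn ℂ f (unitBall d)) (hf2 : MemLp f 2 (bergmanMeasure d σ))
    (hNf : MemLp (numOp f) 2 (bergmanMeasure d σ)) :
    0 ≤ (∫ z, conj (f z) * numOp f z ∂bergmanMeasure d σ).re := by
  have hc := isCircular_bergmanMeasure d σ
  have hr : ∀ z, ∃ r : ℝ, 0 ≤ r ∧ (z ∈ unitBall d →
      Real.circleAverage (fun t : ℂ => conj (f (t • z)) * numOp f (t • z)) 0 1 = r) := by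
    intro z
    by_cases hz : z ∈ unitBall d
    · obtain ⟨R, hR, hs⟩ := exists_one_lt_slice hz
      have hsub : Metric.sphere (0 : ℂ) |1| ⊆ Metric.ball 0 R := by
        rw [abs_one]
        exact Metric.sphere_subset_closedBall.trans (Metric.closedBall_subset_ball hR)
      obtain ⟨r, hr, key⟩ := circleAverage_conj_mul_deriv_nonneg hR (hs f hf).1
      refine ⟨r, hr, fun _ => ?_⟩
      rw [← key]
      exact Real.circleAverage_congr_sphere fun t ht => by simp only [(hs f hf).2 t (hsub ht)]
    · exact ⟨0, le_rfl, fun h => absurd h hz⟩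
  choose r hr0 hr using hr
  rw [← hc.integral_circleAverage (integrable_conj_mul hf2 hNf),
    integral_congr_ae ((ae_mem_unitBall d σ).mono hr), integral_complex_ofReal, Complex.ofReal_re]
  exact integral_nonneg hr0

/-! ### The powers of the number operator as maps to `L²` -/

open Classical in
/-- The linear map `f ↦ N^k f` from `H(𝔹^d, lam)` to `L²(𝔹^d, μ_{lam+2n})`, for `k ≤ n`
(and the zero map for `k > n`). -/
noncomputable def numPow (d : ℕ) (lam : ℝ) (n k : ℕ) :
    genBergman d lam n →ₗ[ℂ] Lp ℂ 2 (bergmanMeasure d (lam + 2 * n)) :=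
  if hk : k ≤ n then
    { toFun := fun f => (f.2.2 k hk).2.toLp _
      map_add' := fun f g => by
        rw [← MemLp.toLp_add]
        refine MemLp.toLp_congr _ _ ((ae_mem_unitBall d _).mono fun z hz => ?_)
        exact iterate_numOp_add (fun j hj => (f.2.2 j hj).1) (fun j hj => (g.2.2 j hj).1) k hk hz
      map_smul' := fun c f => by
        rw [RingHom.id_apply, ← MemLp.toLp_const_smul]
        refine MemLp.toLp_congr _ _ ((ae_mem_unitBall d _).mono fun z hz => ?_)
        exact iterate_numOp_smul c (fun j hj => (f.2.2 j hj).1) k hk hz }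
  else 0

section numPow

variable {d : ℕ} {lam : ℝ} {n : ℕ}

theorem numPow_apply {k : ℕ} (hk : k ≤ n) (f : genBergman d lam n) :
    numPow d lam n k f = (f.2.2 k hk).2.toLp _ := by
  simp only [numPow, dif_pos hk]
  rfl

theorem coeFn_numPow {k : ℕ} (hk : k ≤ n) (f : genBergman d lam n) :
    numPow d lam n k f =ᵐ[bergmanMeasure d (lam + 2 * n)] numOp^[k] f := by
  rw [numPow_apply hk]
  exact MemLp.coeFn_toLp _

theorem inner_numPow {j k : ℕ} (hj : j ≤ n) (hk : k ≤ n) (f g : genBergman d lam n) :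
    inner ℂ (numPow d lam n j f) (numPow d lam n k g) =
      ∫ z, conj (numOp^[j] f z) * numOp^[k] g z ∂bergmanMeasure d (lam + 2 * n) := by
  rw [L2.inner_def]
  refine integral_congr_ae ?_
  filter_upwards [coeFn_numPow hj f, coeFn_numPow hk g] with z h1 h2
  rw [h1, h2, RCLike.inner_apply, mul_comm]

theorem inner_numPow_succ {j k : ℕ} (hj : j + 1 ≤ n) (hk : k + 1 ≤ n) (f g : genBergman d lam n) :
    inner ℂ (numPow d lam n (j + 1) f) (numPow d lam n k g) =
      inner ℂ (numPow d lam n j f) (numPow d lam n (k + 1) g) := by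
  have hj' : j ≤ n := by omega
  have hk' : k ≤ n := by omega
  have h1 := (f.2.2 _ hj).2
  have h2 := (g.2.2 _ hk).2
  rw [Function.iterate_succ_apply'] at h1 h2
  rw [inner_numPow hj hk', inner_numPow hj' hk, Function.iterate_succ_apply',
    Function.iterate_succ_apply']
  exact integral_conj_numOp_mul (f.2.2 _ hj').1 (g.2.2 _ hk').1 (f.2.2 _ hj').2 (g.2.2 _ hk').2
    h1 h2

theorem inner_numPow_add {j k : ℕ} (i : ℕ) (hj : j + i ≤ n) (hk : k + i ≤ n)
    (f g : genBergman d lam n) :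
    inner ℂ (numPow d lam n (j + i) f) (numPow d lam n k g) =
      inner ℂ (numPow d lam n j f) (numPow d lam n (k + i) g) := by
  induction i generalizing k with
  | zero => rfl
  | succ i ih =>
    rw [← add_assoc, inner_numPow_succ (by omega) (by omega), ih (by omega) (by omega),
      add_assoc, add_comm 1 i]

/-- Symmetry of `N` lets powers pass from one side to the other, as long as neither exponent exceeds
`n`, beyond which `N^k f` need not be in `L²`. -/
theorem inner_numPow_eq_of_add_eq {j k j' k' : ℕ} (hj : j ≤ n) (hk : k ≤ n) (hj' : j' ≤ n)
    (hk' : k' ≤ n) (h : j + k = j' + k') (f g : genBergman d lam n) :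
    inner ℂ (numPow d lam n j f) (numPow d lam n k g) =
      inner ℂ (numPow d lam n j' f) (numPow d lam n k' g) := by
  rcases le_total j j' with hjj | hjj
  · obtain ⟨i, rfl⟩ := Nat.exists_eq_add_of_le hjj
    obtain rfl : k = k' + i := by omega
    exact (inner_numPow_add i hj' hk f g).symm
  · obtain ⟨i, rfl⟩ := Nat.exists_eq_add_of_le hjj
    obtain rfl : k' = k + i := by omega
    exact inner_numPow_add i hj hk' f g

/-- Balance the exponents until they are equal, which gives a squared norm, or differ by one, which
gives `⟨g, N g⟩` with `g = N^p f`. -/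
theorem re_inner_numPow_nonneg {j k : ℕ} (hj : j ≤ n) (hk : k ≤ n) (f : genBergman d lam n) :
    0 ≤ (inner ℂ (numPow d lam n j f) (numPow d lam n k f)).re := by
  obtain ⟨p, hp⟩ : ∃ p, j + k = p + p ∨ j + k = p + (p + 1) := ⟨(j + k) / 2, by omega⟩
  rcases hp with hp | hp
  · rw [inner_numPow_eq_of_add_eq hj hk (by omega) (by omega) hp]
    exact inner_self_nonneg (𝕜 := ℂ)
  · have h1 : p + 1 ≤ n := by omega
    rw [inner_numPow_eq_of_add_eq hj hk (by omega) h1 hp, inner_numPow (by omega) h1,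
      Function.iterate_succ_apply']
    have h2 := (f.2.2 _ h1).2
    rw [Function.iterate_succ_apply'] at h2
    exact integral_conj_mul_numOp_nonneg (f.2.2 p (by omega)).1 (f.2.2 p (by omega)).2 h2

end numPow

/-! ### Expansion of `(I + N/a) ⋯ (I + N/(a+k-1))` in powers of `N` -/

/-- The coefficient of `N^j` in `(I + N/a) (I + N/(a+1)) ⋯ (I + N/(a+k-1))`. -/
noncomputable def shiftCoeff (a : ℝ) : ℕ → ℕ → ℝ
  | 0, 0 => 1
  | 0, _ + 1 => 0
  | k + 1, 0 => shiftCoeff a k 0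
  | k + 1, j + 1 => shiftCoeff a k (j + 1) + shiftCoeff a k j / (a + k)

theorem shiftCoeff_eq_zero (a : ℝ) {k j : ℕ} (h : k < j) : shiftCoeff a k j = 0 := by
  induction k generalizing j with
  | zero =>
    obtain ⟨i, rfl⟩ := Nat.exists_eq_succ_of_ne_zero h.ne'
    rfl
  | succ k ih =>
    obtain ⟨i, rfl⟩ := Nat.exists_eq_succ_of_ne_zero (Nat.ne_zero_of_lt h)
    rw [shiftCoeff, ih (by omega), ih (by omega), zero_div, add_zero]

theorem shiftCoeff_nonneg {a : ℝ} (ha : 0 < a) (k j : ℕ) : 0 ≤ shiftCoeff a k j := by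
  induction k generalizing j with
  | zero => cases j <;> simp [shiftCoeff]
  | succ k ih =>
    cases j with
    | zero => exact ih 0
    | succ j =>
      have h1 := ih (j + 1)
      have h2 := ih j
      rw [shiftCoeff]
      positivity

theorem shiftCoeff_pos {a : ℝ} (ha : 0 < a) {k j : ℕ} (h : j ≤ k) : 0 < shiftCoeff a k j := by
  induction k generalizing j with
  | zero =>
    obtain rfl : j = 0 := by omega
    simp [shiftCoeff]
  | succ k ih =>
    cases j with
    | zero => exact ih (Nat.zero_le _)
    | succ j =>
      have h1 := shiftCoeff_nonneg ha k (j + 1)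
      have h2 := ih (j := j) (by omega)
      rw [shiftCoeff]
      positivity

theorem shiftProd_eqOn_sum {d : ℕ} (a : ℝ) {f : Cn d → ℂ} {k : ℕ}
    (hf : ∀ j ≤ k, DifferentiableOn ℂ (numOp^[j] f) (unitBall d)) :
    Set.EqOn (shiftProd a k f)
      (fun z => ∑ j ∈ Finset.range (k + 1), (shiftCoeff a k j : ℂ) * numOp^[j] f z)
      (unitBall d) := by
  induction k with
  | zero =>
    intro z _
    simp [shiftProd, shiftCoeff]
  | succ k ih =>
    have ih' := ih fun j hj => hf j (by omega)
    intro z hz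
    have hz' := Metric.isOpen_ball.mem_nhds hz
    have hN : numOp (fun z => ∑ j ∈ Finset.range (k + 1), (shiftCoeff a k j : ℂ) * numOp^[j] f z) z =
        ∑ j ∈ Finset.range (k + 1), (shiftCoeff a k j : ℂ) * numOp^[j + 1] f z := by
      have hd : ∀ j ∈ Finset.range (k + 1), DifferentiableAt ℂ (numOp^[j] f) z := fun j hj =>
        (hf j (by have := Finset.mem_range.1 hj; omega)).differentiableAt hz'
      rw [numOp, fderiv_fun_sum fun j hj => (hd j hj).const_mul _]
      rw [sum_apply]
      refine Finset.sum_congr rfl fun j hj => ?_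
      rw [fderiv_const_mul (hd j hj), Function.iterate_succ_apply']
      rfl
    -- Reindexing to match the recursion for `shiftCoeff`; the added top term vanishes because its
    -- coefficient is zero.
    have hc : ∑ j ∈ Finset.range (k + 1), (shiftCoeff a k j : ℂ) * numOp^[j] f z =
        ∑ j ∈ Finset.range (k + 1), (shiftCoeff a k (j + 1) : ℂ) * numOp^[j + 1] f z +
          (shiftCoeff a k 0 : ℂ) * numOp^[0] f z := by
      rw [← Finset.sum_range_succ' (fun j => (shiftCoeff a k j : ℂ) * numOp^[j] f z),
        Finset.sum_range_succ _ (k + 1), shiftCoeff_eq_zero a (Nat.lt_succ_self k)]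
      simp
    change shiftProd a k f z + numOp (shiftProd a k f) z / ((a + k : ℝ) : ℂ) =
      ∑ j ∈ Finset.range (k + 1 + 1), (shiftCoeff a (k + 1) j : ℂ) * numOp^[j] f z
    rw [numOp_congr ih' hz, hN, ih' hz, Finset.sum_range_succ' _ (k + 1)]
    simp only [shiftCoeff]
    rw [hc, Finset.sum_div, add_right_comm, ← Finset.sum_add_distrib]
    congr 1
    refine Finset.sum_congr rfl fun j _ => ?_
    push_cast
    ring

/-! ### The generalized Bergman space as a Hilbert space -/

/-- The conditions on the parameters of the space `H(𝔹^d, lam)`. -/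
class SobolevParams (d : ℕ) (lam : ℝ) (n : ℕ) : Prop where
  dim_pos : 0 < d
  pos : 0 < lam
  lt : (d : ℝ) < lam + 2 * n

/-- The space `H(𝔹^d, lam)`, to be equipped with the inner product `⟨·, ·⟩_lam`. -/
def SobolevSpace (d : ℕ) (lam : ℝ) (n : ℕ) : Type := genBergman d lam n

noncomputable instance (d : ℕ) (lam : ℝ) (n : ℕ) : AddCommGroup (SobolevSpace d lam n) :=
  inferInstanceAs (AddCommGroup (genBergman d lam n))

noncomputable instance (d : ℕ) (lam : ℝ) (n : ℕ) : Module ℂ (SobolevSpace d lam n) :=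
  inferInstanceAs (Module ℂ (genBergman d lam n))

namespace SobolevSpace

/-- The tautological identification of `SobolevSpace` with the space of functions. -/
def toGen (d : ℕ) (lam : ℝ) (n : ℕ) : SobolevSpace d lam n ≃ₗ[ℂ] genBergman d lam n :=
  LinearEquiv.refl ℂ (genBergman d lam n)

/-- The function `N^k f` as an element of `L²`. -/
noncomputable def npow (d : ℕ) (lam : ℝ) (n k : ℕ) :
    SobolevSpace d lam n →ₗ[ℂ] Lp ℂ 2 (bergmanMeasure d (lam + 2 * n)) :=
  numPow d lam n k ∘ₗ (toGen d lam n).toLinearMap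

/-- The operator `(I + N/a) ⋯ (I + N/(a+n-1))` with values in `L²`. -/
noncomputable def shift (d : ℕ) (lam : ℝ) (n : ℕ) (a : ℝ) :
    SobolevSpace d lam n →ₗ[ℂ] Lp ℂ 2 (bergmanMeasure d (lam + 2 * n)) :=
  ∑ j ∈ Finset.range (n + 1), (shiftCoeff a n j : ℂ) • npow d lam n j

variable {d : ℕ} {lam : ℝ} {n : ℕ}

theorem shift_apply (a : ℝ) (f : SobolevSpace d lam n) :
    shift d lam n a f =
      ∑ j ∈ Finset.range (n + 1), (shiftCoeff a n j : ℂ) • npow d lam n j f := by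
  rw [shift, LinearMap.sum_apply]
  rfl

theorem coeFn_shift (a : ℝ) (f : SobolevSpace d lam n) :
    shift d lam n a f =ᵐ[bergmanMeasure d (lam + 2 * n)] shiftProd a n (toGen d lam n f) := by
  rw [shift_apply]
  have h1 : ∀ᵐ z ∂bergmanMeasure d (lam + 2 * n), ∀ j ∈ Finset.range (n + 1),
      ((shiftCoeff a n j : ℂ) • npow d lam n j f : Lp ℂ 2 (bergmanMeasure d (lam + 2 * n))) z =
        (shiftCoeff a n j : ℂ) * numOp^[j] (toGen d lam n f) z := by
    refine (Finset.eventually_all _).2 fun j hj => ?_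
    filter_upwards [Lp.coeFn_smul (shiftCoeff a n j : ℂ) (npow d lam n j f),
      coeFn_numPow (by have := Finset.mem_range.1 hj; omega : j ≤ n) (toGen d lam n f)] with z h1 h2
    rw [h1, Pi.smul_apply, smul_eq_mul, ← h2]
    rfl
  have h2 := Lp.coeFn_finsetSum (Finset.range (n + 1))
    (fun j => (shiftCoeff a n j : ℂ) • npow d lam n j f)
  filter_upwards [h1, h2, ae_mem_unitBall d _] with z h1 h2 hz
  rw [h2, shiftProd_eqOn_sum a (fun j hj => ((toGen d lam n f).2.2 j hj).1) hz, Finset.sum_apply]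
  exact Finset.sum_congr rfl h1

theorem inner_shift (a b : ℝ) (f g : SobolevSpace d lam n) :
    inner ℂ (shift d lam n a f) (shift d lam n b g) =
      ∑ j ∈ Finset.range (n + 1), ∑ k ∈ Finset.range (n + 1),
        ((shiftCoeff a n j * shiftCoeff b n k : ℝ) : ℂ) *
          inner ℂ (npow d lam n j f) (npow d lam n k g) := by
  rw [shift_apply, shift_apply, sum_inner]
  refine Finset.sum_congr rfl fun j _ => ?_
  rw [inner_sum]
  refine Finset.sum_congr rfl fun k _ => ?_
  rw [inner_smul_left, inner_smul_right, Complex.conj_ofReal, Complex.ofReal_mul, mul_assoc]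

theorem sobolevForm_eq_inner (f g : SobolevSpace d lam n) :
    sobolevForm d lam n (toGen d lam n f) (toGen d lam n g) =
      inner ℂ (shift d lam n (lam + n) f) (shift d lam n lam g) := by
  rw [L2.inner_def, sobolevForm]
  refine integral_congr_ae ?_
  filter_upwards [coeFn_shift (lam + n) f, coeFn_shift lam g] with z h1 h2
  rw [h1, h2, RCLike.inner_apply, mul_comm]

/-- The terms depend only on the sum of the exponents, so the two operators may be exchanged. This
is the Hermitian symmetry of `⟨A f, B g⟩`. -/
theorem inner_shift_comm (a b : ℝ) (f g : SobolevSpace d lam n) :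
    inner ℂ (shift d lam n a f) (shift d lam n b g) =
      inner ℂ (shift d lam n b f) (shift d lam n a g) := by
  rw [inner_shift, inner_shift, Finset.sum_comm]
  refine Finset.sum_congr rfl fun j hj => Finset.sum_congr rfl fun k hk => ?_
  have hj : j ≤ n := by have := Finset.mem_range.1 hj; omega
  have hk : k ≤ n := by have := Finset.mem_range.1 hk; omega
  rw [mul_comm (shiftCoeff a n k)]
  congr 1
  exact inner_numPow_eq_of_add_eq hk hj hj hk (add_comm _ _) _ _

/-- Coercivity of the form: every term of the double expansion has nonnegative real part, and the
diagonal term `(k, k)` alone is kept. -/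
theorem mul_norm_npow_sq_le {a b : ℝ} (ha : 0 < a) (hb : 0 < b) {k : ℕ} (hk : k ≤ n)
    (f : SobolevSpace d lam n) :
    shiftCoeff a n k * shiftCoeff b n k * ‖npow d lam n k f‖ ^ 2 ≤
      (inner ℂ (shift d lam n a f) (shift d lam n b f)).re := by
  rw [inner_shift, Complex.re_sum]
  simp only [Complex.re_sum, Complex.re_ofReal_mul]
  have hnn : ∀ i ∈ Finset.range (n + 1), ∀ j ∈ Finset.range (n + 1),
      0 ≤ shiftCoeff a n i * shiftCoeff b n j *
        (inner ℂ (npow d lam n i f) (npow d lam n j f)).re := by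
    intro i hi j hj
    refine mul_nonneg (mul_nonneg (shiftCoeff_nonneg ha _ _) (shiftCoeff_nonneg hb _ _)) ?_
    exact re_inner_numPow_nonneg (by have := Finset.mem_range.1 hi; omega)
      (by have := Finset.mem_range.1 hj; omega) _
  have hk' : k ∈ Finset.range (n + 1) := Finset.mem_range.2 (by omega)
  have e : ‖npow d lam n k f‖ ^ 2 = (inner ℂ (npow d lam n k f) (npow d lam n k f)).re :=
    (inner_self_eq_norm_sq (𝕜 := ℂ) _).symm
  rw [e]
  exact (Finset.single_le_sum (fun j hj => hnn k hk' j hj) hk').trans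
    (Finset.single_le_sum (fun i hi => Finset.sum_nonneg (hnn i hi)) hk')

theorem exists_norm_apply_le [hp : SobolevParams d lam n] {z : Cn d} (hz : z ∈ unitBall d) :
    ∃ C : ℝ, 0 ≤ C ∧ ∀ f : SobolevSpace d lam n,
      ‖(toGen d lam n f : Cn d → ℂ) z‖ ≤ C * ‖npow d lam n 0 f‖ := by
  obtain ⟨C, hC, hb⟩ := exists_norm_le_eLpNorm hp.lt (norm_nonneg z) (by simpa using hz)
  refine ⟨C, hC, fun f => ?_⟩
  have h0 := (toGen d lam n f).2.2 0 (Nat.zero_le n)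
  have := hb _ h0.1 h0.2 z (by simp)
  rwa [← Lp.norm_toLp _ h0.2, ← numPow_apply (Nat.zero_le n)] at this

theorem eq_zero_of_npow_zero [SobolevParams d lam n] {f : SobolevSpace d lam n}
    (h : npow d lam n 0 f = 0) : f = 0 := by
  refine (toGen d lam n).map_eq_zero_iff.1 (Subtype.ext (funext fun z => ?_))
  by_cases hz : z ∈ unitBall d
  · obtain ⟨C, -, hb⟩ := exists_norm_apply_le (lam := lam) (n := n) hz
    have := hb f
    rw [h, norm_zero, mul_zero] at this
    exact norm_le_zero_iff.1 this
  · exact (toGen d lam n f).2.1 z hz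

variable (d lam n) in
/-- The inner product `⟨·, ·⟩_lam`. -/
@[reducible] noncomputable def core [hp : SobolevParams d lam n] :
    InnerProductSpace.Core ℂ (SobolevSpace d lam n) where
  inner f g := inner ℂ (shift d lam n (lam + n) f) (shift d lam n lam g)
  conj_inner_symm f g := by rw [inner_conj_symm, inner_shift_comm]
  re_inner_nonneg f := by
    have hl := hp.pos
    refine le_trans ?_ (mul_norm_npow_sq_le (by positivity) hl (Nat.zero_le n) f)
    have := shiftCoeff_nonneg (a := lam + n) (by positivity) n 0
    have := shiftCoeff_nonneg hl n 0
    positivity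
  add_left f g h := by rw [map_add, inner_add_left]
  smul_left f g c := by rw [map_smul, inner_smul_left]
  definite f hf := by
    have hl := hp.pos
    have h1 := mul_norm_npow_sq_le (a := lam + n) (by positivity) hl (Nat.zero_le n) f
    rw [hf, Complex.zero_re] at h1
    have h2 := shiftCoeff_pos (a := lam + n) (by positivity) (Nat.zero_le n)
    have h3 := shiftCoeff_pos hl (Nat.zero_le n)
    refine eq_zero_of_npow_zero (norm_eq_zero.1 (pow_eq_zero_iff two_ne_zero |>.1 ?_))
    exact le_antisymm (nonpos_of_mul_nonpos_right h1 (mul_pos h2 h3)) (by positivity)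

noncomputable instance [SobolevParams d lam n] : NormedAddCommGroup (SobolevSpace d lam n) :=
  (core d lam n).toNormedAddCommGroup

noncomputable instance [SobolevParams d lam n] : InnerProductSpace ℂ (SobolevSpace d lam n) :=
  InnerProductSpace.ofCore (core d lam n).toCore

theorem inner_def [SobolevParams d lam n] (f g : SobolevSpace d lam n) :
    inner ℂ f g = inner ℂ (shift d lam n (lam + n) f) (shift d lam n lam g) := rfl

end SobolevSpace

namespace SobolevSpace

variable {d : ℕ} {lam : ℝ} {n : ℕ}

/-! ### Completeness -/

theorem exists_norm_npow_le [hp : SobolevParams d lam n] {k : ℕ} (hk : k ≤ n) :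
    ∃ C : ℝ, 0 ≤ C ∧ ∀ f : SobolevSpace d lam n, ‖npow d lam n k f‖ ≤ C * ‖f‖ := by
  have hl := hp.pos
  have h2 := shiftCoeff_pos (a := lam + n) (by positivity) hk
  have h3 := shiftCoeff_pos hl hk
  set c := shiftCoeff (lam + n) n k * shiftCoeff lam n k with hc
  have hc0 : 0 < c := mul_pos h2 h3
  refine ⟨√(c⁻¹), Real.sqrt_nonneg _, fun f => ?_⟩
  have h1 := mul_norm_npow_sq_le (a := lam + n) (by positivity) hl hk f
  have h4 : ‖f‖ ^ 2 = (inner ℂ f f).re := (inner_self_eq_norm_sq (𝕜 := ℂ) f).symm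
  rw [inner_def] at h4
  rw [← h4] at h1
  rw [← Real.sqrt_sq (norm_nonneg f), ← Real.sqrt_mul (by positivity)]
  refine Real.le_sqrt_of_sq_le ?_
  rwa [inv_mul_eq_div, le_div_iff₀' hc0]

theorem norm_sq_le [SobolevParams d lam n] (f : SobolevSpace d lam n) :
    ‖f‖ ^ 2 ≤ ‖shift d lam n (lam + n) f‖ * ‖shift d lam n lam f‖ := by
  have h4 : ‖f‖ ^ 2 = (inner ℂ f f).re := (inner_self_eq_norm_sq (𝕜 := ℂ) f).symm
  rw [h4, inner_def]
  exact (Complex.re_le_norm _).trans (norm_inner_le_norm _ _)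

theorem tendsto_shift {u : ℕ → SobolevSpace d lam n} {f : SobolevSpace d lam n}
    (h : ∀ k ≤ n, Tendsto (fun i => npow d lam n k (u i)) atTop (𝓝 (npow d lam n k f))) (a : ℝ) :
    Tendsto (fun i => shift d lam n a (u i)) atTop (𝓝 (shift d lam n a f)) := by
  simp only [shift_apply]
  exact tendsto_finsetSum _ fun j hj =>
    (h j (by have := Finset.mem_range.1 hj; omega)).const_smul _

theorem tendsto_of_npow [SobolevParams d lam n] {u : ℕ → SobolevSpace d lam n}
    {f : SobolevSpace d lam n}
    (h : ∀ k ≤ n, Tendsto (fun i => npow d lam n k (u i)) atTop (𝓝 (npow d lam n k f))) :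
    Tendsto u atTop (𝓝 f) := by
  have h0 : ∀ a, Tendsto (fun i => ‖shift d lam n a (u i - f)‖) atTop (𝓝 0) := by
    intro a
    simp only [map_sub]
    exact tendsto_iff_norm_sub_tendsto_zero.1 (tendsto_shift h a)
  have h1 : Tendsto (fun i => ‖u i - f‖ ^ 2) atTop (𝓝 0) :=
    squeeze_zero (fun i => by positivity) (fun i => norm_sq_le _)
      (by simpa using (h0 (lam + n)).mul (h0 lam))
  rw [tendsto_iff_norm_sub_tendsto_zero]
  simpa [Real.sqrt_sq] using h1.sqrt

/-- By coercivity each sequence `N^k u_i`, `k ≤ n`, is Cauchy in `L²`, with a holomorphic limit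
`g_k`. Pointwise convergence of derivatives forces `N g_k = g_{k+1}`, so the limit of `u_i` is
`g_0`. -/
instance [hp : SobolevParams d lam n] : CompleteSpace (SobolevSpace d lam n) := by
  refine Metric.complete_of_cauchySeq_tendsto fun u hu => ?_
  have hN : ∀ k ≤ n, ∃ G, Tendsto (fun i => npow d lam n k (u i)) atTop (𝓝 G) := by
    intro k hk
    obtain ⟨C, hC, hb⟩ := exists_norm_npow_le (d := d) (lam := lam) hk
    refine cauchySeq_tendsto_of_complete ?_
    exact hu.map ((npow d lam n k).mkContinuous C hb).uniformContinuous
  have hg : ∀ k : ℕ, ∃ g : Cn d → ℂ, k ≤ n → DifferentiableOn ℂ g (unitBall d) ∧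
      (∃ hg2 : MemLp g 2 (bergmanMeasure d (lam + 2 * n)),
        Tendsto (fun i => npow d lam n k (u i)) atTop (𝓝 (hg2.toLp g))) ∧
      ∀ z ∈ unitBall d, Tendsto (fun i => numOp^[k] (toGen d lam n (u i)) z) atTop (𝓝 (g z)) ∧
        Tendsto (fun i => numOp^[k + 1] (toGen d lam n (u i)) z) atTop (𝓝 (numOp g z)) := by
    intro k
    by_cases hk : k ≤ n
    · obtain ⟨G, hG⟩ := hN k hk
      have hmem := fun i => (toGen d lam n (u i)).2.2 k hk
      have hG' : Tendsto (fun i => (hmem i).2.toLp _) atTop (𝓝 G) := by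
        simp only [← numPow_apply hk]
        exact hG
      obtain ⟨g, hgd, hgG, hlim⟩ := exists_differentiableOn_limit hp.lt (fun i => (hmem i).1)
        (fun i => (hmem i).2) hG'
      have hg2 := (memLp_congr_ae hgG).1 (Lp.memLp G)
      have e : hg2.toLp g = G := Lp.ext (hg2.coeFn_toLp.trans hgG.symm)
      refine ⟨g, fun _ => ⟨hgd, ⟨hg2, by rwa [e]⟩, fun z hz => ⟨(hlim z hz).1, ?_⟩⟩⟩
      simp only [Function.iterate_succ_apply', numOp]
      exact ((ContinuousLinearMap.apply ℂ ℂ z).continuous.tendsto _).comp (hlim z hz).2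
    · exact ⟨0, fun h => absurd h hk⟩
  choose g hg using hg
  let F : Cn d → ℂ := (unitBall d).indicator (g 0)
  have hF : ∀ k ≤ n, Set.EqOn (numOp^[k] F) (g k) (unitBall d) := by
    intro k
    induction k with
    | zero => exact fun _ z hz => Set.indicator_of_mem hz _
    | succ k ih =>
      intro hk z hz
      rw [Function.iterate_succ_apply', numOp_congr (ih (by omega)) hz]
      exact tendsto_nhds_unique ((hg k (by omega)).2.2 z hz).2 ((hg (k + 1) hk).2.2 z hz).1
  have hFae : ∀ k ≤ n, g k =ᵐ[bergmanMeasure d (lam + 2 * n)] numOp^[k] F := fun k hk =>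
    (ae_mem_unitBall d _).mono fun z hz => (hF k hk hz).symm
  let F' : genBergman d lam n := ⟨F, fun z hz => Set.indicator_of_notMem hz _, fun k hk =>
    ⟨(hg k hk).1.congr (hF k hk), (memLp_congr_ae (hFae k hk)).1 (hg k hk).2.1.1⟩⟩
  refine ⟨(toGen d lam n).symm F', tendsto_of_npow fun k hk => ?_⟩
  obtain ⟨-, ⟨hg2, hlim⟩, -⟩ := hg k hk
  have e : npow d lam n k ((toGen d lam n).symm F') = hg2.toLp (g k) := by
    change numPow d lam n k F' = _
    rw [numPow_apply hk]
    exact MemLp.toLp_congr _ _ (hFae k hk).symm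
  rwa [e]

/-! ### Multiplication by monomials -/

theorem tendsto_apply [SobolevParams d lam n] {u : ℕ → SobolevSpace d lam n}
    {f : SobolevSpace d lam n} (h : Tendsto u atTop (𝓝 f)) (z : Cn d) :
    Tendsto (fun i => (toGen d lam n (u i) : Cn d → ℂ) z) atTop
      (𝓝 ((toGen d lam n f : Cn d → ℂ) z)) := by
  by_cases hz : z ∈ unitBall d
  · obtain ⟨C, hC, hb⟩ := exists_norm_apply_le (lam := lam) (n := n) hz
    obtain ⟨D, hD, hb'⟩ := exists_norm_npow_le (d := d) (lam := lam) (Nat.zero_le n)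
    rw [tendsto_iff_norm_sub_tendsto_zero] at h ⊢
    refine squeeze_zero (fun i => norm_nonneg _) (fun i => ?_) (by simpa using h.const_mul (C * D))
    have := hb (u i - f)
    rw [map_sub] at this
    refine (le_trans this (mul_le_mul_of_nonneg_left (hb' _) hC)).trans_eq ?_
    ring
  · simp only [(toGen d lam n _).2.1 z hz]
    exact tendsto_const_nhds

end SobolevSpace

/-- The monomial `z^m`. -/
def monom {d : ℕ} (m : Fin d → ℕ) (z : Cn d) : ℂ := ∏ j, z j ^ m j

theorem differentiable_monom {d : ℕ} (m : Fin d → ℕ) : Differentiable ℂ (monom m) := by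
  unfold monom
  fun_prop

theorem monom_smul {d : ℕ} (m : Fin d → ℕ) (t : ℂ) (z : Cn d) :
    monom m (t • z) = t ^ (∑ j, m j) * monom m z := by
  simp only [monom, PiLp.smul_apply, smul_eq_mul, mul_pow, Finset.prod_mul_distrib,
    Finset.prod_pow_eq_pow_sum]

theorem numOp_monom {d : ℕ} (m : Fin d → ℕ) (z : Cn d) :
    numOp (monom m) z = (∑ j, m j : ℕ) * monom m z := by
  have h1 : HasDerivAt (fun t : ℂ => t • z) z 1 := by
    simpa using (hasDerivAt_id (1 : ℂ)).smul_const z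
  have h2 : HasFDerivAt (monom m) (fderiv ℂ (monom m) z) ((1 : ℂ) • z) := by
    rw [one_smul]
    exact (differentiable_monom m z).hasFDerivAt
  have h3 := h2.comp_hasDerivAt (1 : ℂ) h1
  have h4 : HasDerivAt (fun t : ℂ => t ^ (∑ j, m j) * monom m z)
      ((∑ j, m j : ℕ) * monom m z) 1 := by
    simpa using (hasDerivAt_pow (∑ j, m j) (1 : ℂ)).mul_const (monom m z)
  have e : (monom m ∘ fun t : ℂ => t • z) = fun t : ℂ => t ^ (∑ j, m j) * monom m z :=
    funext fun t => monom_smul m t z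
  rw [e] at h3
  exact h3.unique h4

theorem numOp_monom_mul {d : ℕ} (m : Fin d → ℕ) {f : Cn d → ℂ}
    (hf : DifferentiableOn ℂ f (unitBall d)) :
    Set.EqOn (numOp (monom m * f)) (monom m * (numOp f + ((∑ j, m j : ℕ) : ℂ) • f))
      (unitBall d) := by
  intro z hz
  have h := fderiv_mul (differentiable_monom m z)
    (hf.differentiableAt (Metric.isOpen_ball.mem_nhds hz))
  have h2 := numOp_monom m z
  simp only [numOp] at h2
  simp only [numOp, h, add_apply, smul_apply, smul_eq_mul,
    h2, Pi.mul_apply, Pi.add_apply, Pi.smul_apply]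
  ring

theorem iterate_numOp_congr {d : ℕ} {f g : Cn d → ℂ} (h : Set.EqOn f g (unitBall d)) (k : ℕ) :
    Set.EqOn (numOp^[k] f) (numOp^[k] g) (unitBall d) := by
  induction k with
  | zero => exact h
  | succ k ih =>
    simp only [Function.iterate_succ_apply']
    exact numOp_congr ih

theorem norm_monom_le {d : ℕ} (m : Fin d → ℕ) {z : Cn d} (hz : z ∈ unitBall d) :
    ‖monom m z‖ ≤ 1 := by
  have hz : ‖z‖ < 1 := by simpa using hz
  rw [monom, norm_prod]
  refine Finset.prod_le_one (fun _ _ => norm_nonneg _) fun j _ => ?_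
  rw [norm_pow]
  exact pow_le_one₀ (norm_nonneg _) ((PiLp.norm_apply_le z j).trans hz.le)

/-- Since `N (z^m f) = z^m (N f + |m| f)`, induction on `k` passes from `f` to `N f + |m| f`. -/
theorem iterate_numOp_monom_mul {d : ℕ} {σ : ℝ} (m : Fin d → ℕ) {k : ℕ} {f : Cn d → ℂ}
    (hf : ∀ j ≤ k, DifferentiableOn ℂ (numOp^[j] f) (unitBall d) ∧
      MemLp (numOp^[j] f) 2 (bergmanMeasure d σ)) :
    DifferentiableOn ℂ (numOp^[k] (monom m * f)) (unitBall d) ∧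
      MemLp (numOp^[k] (monom m * f)) 2 (bergmanMeasure d σ) := by
  induction k generalizing f with
  | zero =>
    obtain ⟨h1, h2⟩ := hf 0 le_rfl
    refine ⟨(differentiable_monom m).differentiableOn.mul h1, h2.of_le
      ((differentiable_monom m).continuous.aestronglyMeasurable.mul h2.1) ?_⟩
    filter_upwards [ae_mem_unitBall d σ] with z hz
    simp only [Function.iterate_zero, id, Pi.mul_apply, norm_mul]
    exact mul_le_of_le_one_left (norm_nonneg _) (norm_monom_le m hz)
  | succ k ih =>
    set c : ℂ := ((∑ j, m j : ℕ) : ℂ) with hc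
    have hf0 : ∀ j ≤ k, DifferentiableOn ℂ (numOp^[j] f) (unitBall d) := fun j hj =>
      (hf j (by omega)).1
    have hf1 : ∀ j ≤ k, DifferentiableOn ℂ (numOp^[j] (numOp f)) (unitBall d) := fun j hj =>
      (hf (j + 1) (by omega)).1
    have hcf : ∀ j ≤ k, Set.EqOn (numOp^[j] (c • f)) (c • numOp^[j] f) (unitBall d) :=
      iterate_numOp_smul c hf0
    have hcf0 : ∀ j ≤ k, DifferentiableOn ℂ (numOp^[j] (c • f)) (unitBall d) := fun j hj =>
      ((hf0 j hj).const_smul c).congr (hcf j hj)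
    have hsum := iterate_numOp_add hf1 hcf0
    have key := ih (f := numOp f + c • f) fun j hj => by
      refine ⟨((hf1 j hj).add (hcf0 j hj)).congr (hsum j hj), ?_⟩
      refine (memLp_congr_ae ?_).2 ((hf (j + 1) (by omega)).2.add
        ((hf j (by omega)).2.const_smul c))
      filter_upwards [ae_mem_unitBall d σ] with z hz
      rw [hsum j hj hz, Pi.add_apply, hcf j hj hz, Pi.add_apply]
      rfl
    have e := iterate_numOp_congr (numOp_monom_mul m (hf 0 (by omega)).1) k
    rw [Function.iterate_zero, id] at e
    rw [Function.iterate_succ_apply]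
    exact ⟨key.1.congr e, (memLp_congr_ae ((ae_mem_unitBall d σ).mono e)).2 key.2⟩

namespace SobolevSpace

variable {d : ℕ} {lam : ℝ} {n : ℕ}

variable (lam n) in
/-- Multiplication by `z^m` as a linear map. -/
noncomputable def monomMulₗ (m : Fin d → ℕ) :
    SobolevSpace d lam n →ₗ[ℂ] SobolevSpace d lam n :=
  (toGen d lam n).symm.toLinearMap ∘ₗ
    { toFun := fun f : genBergman d lam n => (⟨monom m * f, fun z hz => by simp [f.2.1 z hz],
        fun _ hk => iterate_numOp_monom_mul m fun j hj => f.2.2 j (hj.trans hk)⟩ :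
          genBergman d lam n)
      map_add' := fun f g => Subtype.ext (mul_add _ _ _)
      map_smul' := fun c f => Subtype.ext (mul_smul_comm _ _ _) } ∘ₗ (toGen d lam n).toLinearMap

variable (lam n) in
/-- Multiplication by `z^m` as a bounded operator. -/
noncomputable def monomMul [SobolevParams d lam n] (m : Fin d → ℕ) :
    SobolevSpace d lam n →L[ℂ] SobolevSpace d lam n where
  toLinearMap := monomMulₗ lam n m
  cont := by
    -- Closed graph theorem: evaluations are continuous, so the limit of `z^m u_i` is determined
    -- pointwise.
    refine LinearMap.continuous_of_seq_closed_graph _ fun u x y hu hy => ?_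
    refine (toGen d lam n).injective (Subtype.ext (funext fun z => ?_))
    exact tendsto_nhds_unique (tendsto_apply hy z) ((tendsto_apply hu z).const_mul (monom m z))

theorem toGen_monomMul [SobolevParams d lam n] (m : Fin d → ℕ) (f : SobolevSpace d lam n) :
    (toGen d lam n (monomMul lam n m f) : Cn d → ℂ) = monom m * (toGen d lam n f : Cn d → ℂ) :=
  rfl

end SobolevSpace

/-! ### Operators with polynomial symbols applied to the constant function -/

/-- The eigenvalue of `(I + N/a) ⋯ (I + N/(a+k-1))` on homogeneous polynomials of degree `s`. -/
noncomputable def shiftFactor (a : ℝ) (k s : ℕ) : ℝ := ∏ i ∈ Finset.range k, (1 + s / (a + i))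

/-- Each factor is `(a+i+s)/(a+i)`, so the quotient of the products for `s+1` and `s` telescopes. -/
theorem shiftFactor_mul {a : ℝ} (ha : 0 < a) (k s : ℕ) :
    (a + s) * shiftFactor a k (s + 1) = (a + k + s) * shiftFactor a k s := by
  induction k with
  | zero => simp [shiftFactor]
  | succ k ih =>
    have h : a + k ≠ 0 := by positivity
    have e : ∀ s, shiftFactor a (k + 1) s = shiftFactor a k s * (1 + s / (a + k)) := fun s =>
      Finset.prod_range_succ _ _
    rw [e, e, ← mul_assoc, ih]
    push_cast
    field_simp
    ring

theorem shiftFactor_add (a : ℝ) (m n s : ℕ) :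
    shiftFactor a m s * shiftFactor (a + m) n s = shiftFactor a (m + n) s := by
  simp only [shiftFactor, Finset.prod_range_add, Nat.cast_add, add_assoc]

theorem shiftProd_eqOn_monom {d : ℕ} (a : ℝ) {m : Fin d → ℕ} {f : Cn d → ℂ}
    (hf : Set.EqOn f (monom m) (unitBall d)) (k : ℕ) :
    Set.EqOn (shiftProd a k f) (fun z => (shiftFactor a k (∑ j, m j) : ℂ) * monom m z)
      (unitBall d) := by
  induction k with
  | zero =>
    intro z hz
    simpa [shiftProd, shiftFactor] using hf hz
  | succ k ih =>
    intro z hz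
    have hN : numOp (fun z => (shiftFactor a k (∑ j, m j) : ℂ) * monom m z) z =
        (shiftFactor a k (∑ j, m j) : ℂ) * ((∑ j, m j : ℕ) * monom m z) := by
      rw [← numOp_monom, numOp, fderiv_const_mul (differentiable_monom m z)]
      rfl
    change shiftProd a k f z + numOp (shiftProd a k f) z / ((a + k : ℝ) : ℂ) = _
    rw [numOp_congr ih hz, hN, ih hz, shiftFactor, shiftFactor, Finset.prod_range_succ]
    push_cast
    ring

theorem polyToeplitz_eq_sum {d : ℕ} {H : Type*} [NormedAddCommGroup H] [InnerProductSpace ℂ H]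
    [CompleteSpace H] (M : (Fin d → ℕ) → H →L[ℂ] H) {φ : PolySymbol d}
    {S : Finset (Fin d ⊕ Fin d →₀ ℕ)} (hS : φ.support ⊆ S) :
    polyToeplitz M φ = ∑ s ∈ S, φ.coeff s •
      (ContinuousLinearMap.adjoint (M fun j => s (Sum.inl j)) ∘L M fun j => s (Sum.inr j)) :=
  Finset.sum_subset hS fun s _ hs => by
    rw [MvPolynomial.notMem_support_iff.1 hs, zero_smul]

theorem polyToeplitz_sub {d : ℕ} {H : Type*} [NormedAddCommGroup H] [InnerProductSpace ℂ H]
    [CompleteSpace H] (M : (Fin d → ℕ) → H →L[ℂ] H) (φ ψ : PolySymbol d) :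
    polyToeplitz M (φ - ψ) = polyToeplitz M φ - polyToeplitz M ψ := by
  classical
  rw [polyToeplitz_eq_sum M (S := φ.support ∪ ψ.support) (MvPolynomial.support_sub _ φ ψ),
    polyToeplitz_eq_sum M (φ := φ) (S := φ.support ∪ ψ.support) Finset.subset_union_left,
    polyToeplitz_eq_sum M (φ := ψ) (S := φ.support ∪ ψ.support) Finset.subset_union_right,
    ← Finset.sum_sub_distrib]
  simp only [MvPolynomial.coeff_sub, sub_smul]

theorem inner_polyToeplitz {d : ℕ} {H : Type*} [NormedAddCommGroup H] [InnerProductSpace ℂ H]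
    [CompleteSpace H] (M : (Fin d → ℕ) → H →L[ℂ] H) (φ : PolySymbol d) (f g : H) :
    inner ℂ f (polyToeplitz M φ g) = ∑ s ∈ φ.support, φ.coeff s *
      inner ℂ (M (fun j => s (Sum.inl j)) f) (M (fun j => s (Sum.inr j)) g) := by
  rw [polyToeplitz, sum_apply, inner_sum]
  refine Finset.sum_congr rfl fun s _ => ?_
  rw [smul_apply, inner_smul_right, ContinuousLinearMap.comp_apply,
    ContinuousLinearMap.adjoint_inner_right]

theorem toFun_eq_sum {d : ℕ} (φ : PolySymbol d) (z : Cn d) :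
    φ.toFun z = ∑ s ∈ φ.support, φ.coeff s *
      (conj (monom (fun j => s (Sum.inl j)) z) * monom (fun j => s (Sum.inr j)) z) := by
  rw [PolySymbol.toFun, MvPolynomial.eval_eq']
  refine Finset.sum_congr rfl fun s _ => ?_
  rw [Fintype.prod_sum_type]
  simp [monom]

theorem toFun_normSqSymbol_pow {d : ℕ} (k : ℕ) (z : Cn d) :
    (normSqSymbol d ^ k).toFun z = ((‖z‖ ^ (2 * k) : ℝ) : ℂ) := by
  have : MvPolynomial.eval (Sum.elim (fun j => conj (z j)) (fun j => z j)) (normSqSymbol d) =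
      ((‖z‖ ^ 2 : ℝ) : ℂ) := by
    simp [normSqSymbol, EuclideanSpace.norm_sq_eq, Complex.conj_mul']
  rw [PolySymbol.toFun, map_pow, this, pow_mul, Complex.ofReal_pow _ k]

/-- `|z|²` is homogeneous of degree `1` both in `z̄` and in `z`; the weights `(1,0)` and `(0,1)`
detect the two degrees. -/
theorem degree_of_mem_support_normSqSymbol_pow {d k : ℕ} {s : Fin d ⊕ Fin d →₀ ℕ}
    (hs : s ∈ (normSqSymbol d ^ k).support) :
    ∑ j, s (Sum.inl j) = k ∧ ∑ j, s (Sum.inr j) = k := by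
  have key : ∀ w : Fin d ⊕ Fin d → ℕ, (∀ j, w (Sum.inl j) + w (Sum.inr j) = 1) →
      Finsupp.weight w s = k := by
    intro w hw
    have h1 : MvPolynomial.IsWeightedHomogeneous w (normSqSymbol d) 1 := by
      refine MvPolynomial.IsWeightedHomogeneous.sum _ _ _ fun j _ => ?_
      rw [← hw j]
      exact (MvPolynomial.isWeightedHomogeneous_X ℂ w _).mul
        (MvPolynomial.isWeightedHomogeneous_X ℂ w _)
    have h2 := h1.pow k
    rw [smul_eq_mul, mul_one] at h2
    exact h2 (MvPolynomial.mem_support_iff.1 hs)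
  have h1 := key (Sum.elim 1 0) (by simp)
  have h2 := key (Sum.elim 0 1) (by simp)
  rw [Finsupp.weight_apply, Finsupp.sum_fintype _ _ (by simp), Fintype.sum_sum_type] at h1 h2
  simp at h1 h2
  exact ⟨h1, h2⟩

theorem norm_toFun_normSqSymbol_pow_le {d : ℕ} (k : ℕ) {z : Cn d} (hz : z ∈ unitBall d) :
    ‖(normSqSymbol d ^ k).toFun z‖ ≤ 1 := by
  have hz : ‖z‖ < 1 := by simpa using hz
  rw [toFun_normSqSymbol_pow, Complex.norm_real, norm_pow, norm_norm]
  exact pow_le_one₀ (norm_nonneg _) hz.le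

theorem supOnBall_normSqSymbol_pow_le (d k : ℕ) : supOnBall (normSqSymbol d ^ k).toFun ≤ 1 :=
  Real.iSup_le (fun z => norm_toFun_normSqSymbol_pow_le k z.2) zero_le_one

/-! ### Moments of `|z|^{2k}` at the constant function -/

namespace SobolevSpace

variable (d : ℕ) (lam : ℝ) (n : ℕ)

/-- The constant function `1` on the ball. -/
noncomputable def one [hp : SobolevParams d lam n] : SobolevSpace d lam n :=
  (toGen d lam n).symm ⟨(unitBall d).indicator 1, fun _ hz => Set.indicator_of_notMem hz _,
    fun k _ => by
      have := isFiniteMeasure_bergmanMeasure hp.dim_pos hp.lt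
      have h1 : ∃ c : ℂ, numOp^[k] (1 : Cn d → ℂ) = fun _ => c := by
        rcases k with _ | k
        · exact ⟨1, rfl⟩
        · have : numOp (1 : Cn d → ℂ) = 0 := by
            funext z
            have : (1 : Cn d → ℂ) = fun _ => 1 := rfl
            simp [numOp, this]
          exact ⟨0, by rw [Function.iterate_succ_apply, this, iterate_numOp_zero]; rfl⟩
      obtain ⟨c, hc⟩ := h1
      have h2 := iterate_numOp_congr
        (Set.eqOn_indicator : Set.EqOn ((unitBall d).indicator 1) (1 : Cn d → ℂ) _) k
      rw [hc] at h2
      exact ⟨(differentiableOn_const c).congr h2,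
        (memLp_congr_ae ((ae_mem_unitBall d _).mono h2)).2 (memLp_const c)⟩⟩

variable [hp : SobolevParams d lam n]

theorem toGen_one {z : Cn d} (hz : z ∈ unitBall d) :
    (toGen d lam n (one d lam n) : Cn d → ℂ) z = 1 :=
  Set.indicator_of_mem hz _

theorem one_ne_zero : one d lam n ≠ 0 := by
  intro h
  have := toGen_one d lam n (z := 0) (by simp)
  rw [h, map_zero] at this
  exact zero_ne_one this

theorem monomMul_zero_one : monomMul lam n 0 (one d lam n) = one d lam n := by
  refine (toGen d lam n).injective (Subtype.ext (funext fun z => ?_))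
  rw [toGen_monomMul, Pi.mul_apply]
  simp [monom]

theorem inner_monomMul_one (l m : Fin d → ℕ) :
    inner ℂ (monomMul lam n l (one d lam n)) (monomMul lam n m (one d lam n)) =
      ((shiftFactor (lam + n) n (∑ j, l j) * shiftFactor lam n (∑ j, m j) : ℝ) : ℂ) *
        ∫ z, conj (monom l z) * monom m z ∂bergmanMeasure d (lam + 2 * n) := by
  have h : ∀ m : Fin d → ℕ, Set.EqOn (toGen d lam n (monomMul lam n m (one d lam n)) : Cn d → ℂ)
      (monom m) (unitBall d) := by
    intro m z hz
    rw [toGen_monomMul, Pi.mul_apply, toGen_one d lam n hz, mul_one]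
  rw [inner_def, ← sobolevForm_eq_inner, sobolevForm, ← integral_const_mul]
  refine integral_congr_ae ?_
  filter_upwards [ae_mem_unitBall d _] with z hz
  rw [shiftProd_eqOn_monom _ (h l) _ hz, shiftProd_eqOn_monom _ (h m) _ hz, map_mul,
    Complex.conj_ofReal]
  push_cast
  ring

/-- The numbers `⟨1, T_{|z|^{2k}} 1⟩_lam`. -/
noncomputable def moment (k : ℕ) : ℝ :=
  shiftFactor lam (2 * n) k * ∫ z, ‖z‖ ^ (2 * k) ∂bergmanMeasure d (lam + 2 * n)

/-- All monomials of `|z|^{2k}` have bidegree `(k, k)`, so `A` and `B` contribute one common scalar,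
and the remaining integrals add up to `∫ |z|^{2k}`. -/
theorem inner_one_polyToeplitz (k : ℕ) :
    inner ℂ (one d lam n) (polyToeplitz (monomMul lam n) (normSqSymbol d ^ k) (one d lam n)) =
      moment d lam n k := by
  have := isFiniteMeasure_bergmanMeasure hp.dim_pos hp.lt
  have hint : ∀ l m : Fin d → ℕ, Integrable (fun z => conj (monom l z) * monom m z)
      (bergmanMeasure d (lam + 2 * n)) := by
    intro l m
    refine Integrable.of_bound (C := 1) ?_ ?_
    · exact ((Complex.continuous_conj.comp (differentiable_monom l).continuous).mul
        (differentiable_monom m).continuous).aestronglyMeasurable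
    · filter_upwards [ae_mem_unitBall d _] with z hz
      rw [norm_mul, RCLike.norm_conj]
      exact mul_le_one₀ (norm_monom_le l hz) (norm_nonneg _) (norm_monom_le m hz)
  rw [inner_polyToeplitz, moment, Complex.ofReal_mul, ← integral_complex_ofReal]
  simp only [← toFun_normSqSymbol_pow, toFun_eq_sum]
  rw [integral_finsetSum _ fun s _ => (hint _ _).const_mul _, Finset.mul_sum]
  refine Finset.sum_congr rfl fun s hs => ?_
  obtain ⟨h1, h2⟩ := degree_of_mem_support_normSqSymbol_pow hs
  have h3 : shiftFactor (lam + n) n k * shiftFactor lam n k = shiftFactor lam (2 * n) k := by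
    rw [mul_comm, shiftFactor_add, two_mul]
  rw [inner_monomMul_one, h1, h2, h3, integral_const_mul]
  ring

/-- The factor `λ+2n+k` gained by the scalar cancels against the one lost by the integral, so `n`
drops out of the ratio. -/
theorem moment_succ (k : ℕ) : (lam + k) * moment d lam n (k + 1) = (d + k) * moment d lam n k := by
  have h1 := shiftFactor_mul hp.pos (2 * n) k
  have h2 := integral_norm_pow_bergmanMeasure hp.dim_pos hp.lt k
  push_cast at h1
  rw [moment, moment, ← mul_assoc, h1, mul_right_comm, h2]
  ring

theorem moment_zero : moment d lam n 0 = ‖one d lam n‖ ^ 2 := by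
  have h1 := inner_monomMul_one d lam n 0 0
  rw [monomMul_zero_one, inner_self_eq_norm_sq_to_K] at h1
  have h2 : ((moment d lam n 0 : ℝ) : ℂ) = ((‖one d lam n‖ ^ 2 : ℝ) : ℂ) := by
    rw [Complex.ofReal_pow]
    refine Eq.trans ?_ h1.symm
    simp [moment, shiftFactor, monom]
  exact_mod_cast h2

theorem moment_zero_pos : 0 < moment d lam n 0 := by
  rw [moment_zero]
  have := norm_pos_iff.2 (one_ne_zero d lam n)
  positivity

theorem moment_le_mul_norm (k : ℕ) : moment d lam n k ≤
    moment d lam n 0 * ‖polyToeplitz (monomMul lam n) (normSqSymbol d ^ k)‖ := by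
  have h1 : ‖inner ℂ (one d lam n) (polyToeplitz (monomMul lam n) (normSqSymbol d ^ k)
      (one d lam n))‖ ≤ ‖one d lam n‖ * (‖polyToeplitz (monomMul lam n) (normSqSymbol d ^ k)‖ *
        ‖one d lam n‖) :=
    (norm_inner_le_norm _ _).trans (by gcongr; exact ContinuousLinearMap.le_opNorm _ _)
  rw [inner_one_polyToeplitz, Complex.norm_real] at h1
  rw [moment_zero]
  refine (le_abs_self _).trans (h1.trans (le_of_eq ?_))
  ring

/-- The increment is `m_k (d-λ)/(λ+k)`; use `m_k ≥ m_0` and `λ+k ≤ (λ+1)(k+1)` to compare with the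
harmonic series. -/
theorem moment_lower_bound (hd : lam ≤ d) (k : ℕ) :
    moment d lam n 0 * (1 + (d - lam) / (lam + 1) * ∑ i ∈ Finset.range k, 1 / ((i : ℝ) + 1)) ≤
      moment d lam n k := by
  have hl := hp.pos
  have h0 := moment_zero_pos d lam n
  induction k with
  | zero => simp
  | succ k ih =>
    have hk : 0 < lam + k := by positivity
    have hdl : 0 ≤ d - lam := sub_nonneg.2 hd
    have hmk : moment d lam n 0 ≤ moment d lam n k := by
      refine le_trans ?_ ih
      have : 0 ≤ (d - lam) / (lam + 1) * ∑ i ∈ Finset.range k, 1 / ((i : ℝ) + 1) := by positivity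
      nlinarith
    have h1 : moment d lam n (k + 1) =
        moment d lam n k + moment d lam n k * ((d - lam) * (1 / (lam + k))) := by
      have := moment_succ d lam n k
      field_simp
      linarith
    have h2 : (d - lam) / (lam + 1) * (1 / ((k : ℝ) + 1)) ≤ (d - lam) * (1 / (lam + k)) := by
      rw [div_mul_eq_mul_div, mul_one_div, mul_one_div, div_div]
      gcongr
      nlinarith [mul_nonneg hl.le (Nat.cast_nonneg (α := ℝ) k)]
    have h3 : moment d lam n 0 * ((d - lam) / (lam + 1) * (1 / ((k : ℝ) + 1))) ≤
        moment d lam n k * ((d - lam) * (1 / (lam + k))) :=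
      mul_le_mul hmk h2 (by positivity) (h0.le.trans hmk)
    rw [Finset.sum_range_succ, h1]
    linarith

theorem not_bddAbove_moment (hd : lam < d) (C : ℝ) : ∃ k, C < moment d lam n k := by
  have hl := hp.pos
  have hc : 0 < (d - lam) / (lam + 1) := div_pos (sub_pos.2 hd) (by positivity)
  have ht := (tendsto_atTop_add_const_left atTop 1
    (Real.tendsto_sum_range_one_div_nat_succ_atTop.const_mul_atTop hc)).const_mul_atTop
      (moment_zero_pos d lam n)
  obtain ⟨k, hk⟩ := (ht.eventually_gt_atTop C).exists
  exact ⟨k, hk.trans_le (moment_lower_bound d lam n hd.le k)⟩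

end SobolevSpace

/-! ### The main theorem -/

theorem mainTheorem6 (d : ℕ) (lam : ℝ) :
    ((d : ℝ) < lam →
      ∃ _ : (GenBergman.bergman d lam).HasOrthogonalProjection,
        ∀ (φ : GenBergman.Cn d → ℂ) (hm : Measurable φ) (hb : GenBergman.BddOnBall φ),
          ‖GenBergman.toeplitz lam hm hb‖ ≤ GenBergman.supOnBall φ ∧
          ((∀ z ∈ GenBergman.unitBall d, 0 ≤ (φ z).re ∧ (φ z).im = 0) →
            (GenBergman.toeplitz lam hm hb).IsPositive)) ∧
    (0 < lam → lam < d → ∀ n : ℕ, (d : ℝ) < lam + 2 * n →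
      ∃ (H : Type) (_ : NormedAddCommGroup H) (_ : InnerProductSpace ℂ H) (_ : CompleteSpace H)
        (ι : H ≃ₗ[ℂ] GenBergman.genBergman d lam n) (M : (Fin d → ℕ) → H →L[ℂ] H),
        (∀ f g : H, inner ℂ f g = GenBergman.sobolevForm d lam n (ι f) (ι g)) ∧
        (∀ (m : Fin d → ℕ) (f : H) (z : GenBergman.Cn d),
          (ι (M m f) : GenBergman.Cn d → ℂ) z = (∏ j, z j ^ m j) *
            (ι f : GenBergman.Cn d → ℂ) z) ∧
        (GenBergman.supOnBall (GenBergman.normSqSymbol d).toFun <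
          ‖GenBergman.polyToeplitz M (GenBergman.normSqSymbol d)‖) ∧
        ((∀ z ∈ GenBergman.unitBall d,
            0 ≤ ((1 - GenBergman.normSqSymbol d).toFun z).re ∧
            ((1 - GenBergman.normSqSymbol d).toFun z).im = 0) ∧
          ¬ (GenBergman.polyToeplitz M (1 - GenBergman.normSqSymbol d)).IsPositive ∧
          ∃ f : H,
            (inner ℂ f (GenBergman.polyToeplitz M (1 - GenBergman.normSqSymbol d) f)).re < 0) ∧
        (¬ ∃ C : ℝ, ∀ k : ℕ,
          ‖GenBergman.polyToeplitz M (GenBergman.normSqSymbol d ^ k)‖ ≤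
            C * GenBergman.supOnBall (GenBergman.normSqSymbol d ^ k).toFun) ∧
        (¬ ∃ C : ℝ, ∀ φ : GenBergman.PolySymbol d,
          ‖GenBergman.polyToeplitz M φ‖ ≤ C * GenBergman.supOnBall φ.toFun)) := by
  refine ⟨fun h => ⟨bergman_hasOrthogonalProjection h, fun φ hm hb => ?_⟩, fun hl hd n hn => ?_⟩
  · have := bergman_hasOrthogonalProjection h
    exact ⟨norm_toeplitz_le lam hm hb, isPositive_toeplitz lam hm hb⟩
  -- `0 < λ < d` excludes `d = 0`.
  have hp : SobolevParams d lam n := ⟨by exact_mod_cast hl.trans hd, hl, hn⟩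
  have h0 := SobolevSpace.moment_zero_pos d lam n
  have h01 : SobolevSpace.moment d lam n 0 < SobolevSpace.moment d lam n 1 := by
    have := SobolevSpace.moment_succ d lam n 0
    simp only [Nat.cast_zero, add_zero, zero_add] at this
    nlinarith
  have hneg : (inner ℂ (SobolevSpace.one d lam n)
      (polyToeplitz (SobolevSpace.monomMul lam n) (1 - normSqSymbol d)
        (SobolevSpace.one d lam n))).re < 0 := by
    have e0 := SobolevSpace.inner_one_polyToeplitz d lam n 0
    have e1 := SobolevSpace.inner_one_polyToeplitz d lam n 1
    rw [pow_zero] at e0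
    rw [pow_one] at e1
    rw [polyToeplitz_sub, sub_apply, inner_sub_right, e0, e1, ← Complex.ofReal_sub,
      Complex.ofReal_re]
    linarith
  have hnot : ¬ ∃ C : ℝ, ∀ k : ℕ,
      ‖polyToeplitz (SobolevSpace.monomMul lam n) (normSqSymbol d ^ k)‖ ≤
        C * supOnBall (normSqSymbol d ^ k).toFun := by
    rintro ⟨C, hC⟩
    obtain ⟨k, hk⟩ := SobolevSpace.not_bddAbove_moment d lam n hd
      (SobolevSpace.moment d lam n 0 * |C|)
    have h1 := SobolevSpace.moment_le_mul_norm d lam n k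
    have h2 : ‖polyToeplitz (SobolevSpace.monomMul lam n) (normSqSymbol d ^ k)‖ ≤ |C| :=
      (hC k).trans ((mul_le_mul_of_nonneg_right (le_abs_self C) (supOnBall_nonneg _)).trans
        (mul_le_of_le_one_right (abs_nonneg C) (supOnBall_normSqSymbol_pow_le d k)))
    exact absurd (h1.trans (mul_le_mul_of_nonneg_left h2 h0.le)) (not_le.2 hk)
  refine ⟨SobolevSpace d lam n, inferInstance, inferInstance, inferInstance,
    SobolevSpace.toGen d lam n, SobolevSpace.monomMul lam n,
    fun f g => (SobolevSpace.sobolevForm_eq_inner f g).symm, fun m f z => rfl, ?_,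
    ⟨fun z hz => ?_, fun hpos => ?_, _, hneg⟩, hnot, fun ⟨C, hC⟩ => hnot ⟨C, fun k => hC _⟩⟩
  · have h1 := SobolevSpace.moment_le_mul_norm d lam n 1
    have h2 := supOnBall_normSqSymbol_pow_le d 1
    rw [pow_one] at h1 h2
    refine h2.trans_lt ?_
    -- A norm of at most `1` would give `m_1 ≤ m_0`.
    by_contra hle
    exact absurd (h1.trans (mul_le_of_le_one_right h0.le (not_lt.1 hle))) (not_le.2 h01)
  · have hz1 : ‖z‖ < 1 := by simpa using hz
    have e : (1 - normSqSymbol d).toFun z = ((1 - ‖z‖ ^ 2 : ℝ) : ℂ) := by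
      have := toFun_normSqSymbol_pow 1 z
      rw [pow_one, mul_one] at this
      rw [PolySymbol.toFun] at this ⊢
      rw [map_sub, map_one, this, Complex.ofReal_sub, Complex.ofReal_one]
    rw [e]
    exact ⟨by rw [Complex.ofReal_re]; nlinarith [norm_nonneg z], Complex.ofReal_im _⟩
  · exact absurd (hpos.re_inner_nonneg_right (SobolevSpace.one d lam n)) (not_le.2 hneg)
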